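/- **Theorem (Balanced realization; robustness of the Ho–Kalman algorithm).** Let $n,p\ge 1$ and $L\ge 2$, and write $h=\lfloor L/2\rfloor$ (so $h=L/2$ for even $L$). Let $\mathbf A\in\mathbb R^{n\times n}$, $\mathbf B\in\mathbb R^{n\times p}$, $\mathbf C\in\mathbb R^{p\times n}$ be such that $(\mathbf A,\mathbf B)$ is controllable and $(\mathbf A,\mathbf C)$ is observable. Let $$\mathbf G=[\mathbf C\mathbf B\;\;\mathbf C\mathbf A\mathbf B\;\cdots\;\mathbf C\mathbf A^{L-1}\mathbf B]\in\mathbb R^{p\times pL},$$ $$\mathbf O=\begin{bmatrix}\mathbf C\\ \mathbf C\mathbf A\\ \vdots\\ \mathbf C\mathbf A^{h-1}\end{bmatrix},\qquad \mathbf Q=[\mathbf B\;\;\mathbf A\mathbf B\;\cdots\;\mathbf A^{h}\mathbf B],\qquad \mathbf H=\mathbf O\mathbf Q\in\mathbb R^{ph\times p(h+1)}.$$ The $(i,j)$ block of $\mathbf H$ is the $(i+j)$-th block $\mathbf C\mathbf A^{i+j}\mathbf B$ of $\mathbf G$ (indices from $0$). For an arbitrary matrix $\hat{\mathbf G}\in\mathbb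 R^{p\times pL}$ with $p\times p$ blocks $\hat{\mathbf G}_0,\dots,\hat{\mathbf G}_{L-1}$, let $\hat{\mathbf H}\in\mathbb R^{ph\times p(h+1)}$ be the block Hankel matrix whose $(i,j)$ block is $\hat{\mathbf G}_{i+j}$. *Ho–Kalman algorithm* (order $n$, input a matrix $\mathbf M\in\mathbb R^{ph\times p(h+1)}$). Let $\mathbf M^-$ and $\mathbf M^+$ be $\mathbf M$ without its last, respectively first, $p$ columns. Let $\mathbf K$ be a best Frobenius-norm approximation of $\mathbf M^-$ by matrices of rank at most $n$, and let $\mathbf K=\mathbf U\boldsymbol\Sigma\mathbf V^*$ be a singular value decomposition, with $\mathbf U,\mathbf V\in\mathbb R^{ph\times n}$ having orthonormal columns and $\boldsymbol\Sigma\in\mathbb R^{n\times n}$ diagonal and nonnegative. Put $\mathbf O_{\mathbf M}=\mathbf U\boldsymbol\Sigma^{1/2}$ and $\mathbf Q_{\mathbf M}=\boldsymbol\Sigma^{1/2}\mathbf V^*$. The output is $(\mathbf O_{\mathbf M}^\dagger\mathbf M^+\mathbf Q_{\mathbf M}^\dagger,\ \text{first } p \text{ columns of } \mathbf Q_{\mathbf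 M},\ \text{first } p \text{ rows of } \mathbf O_{\mathbf M})$, where $\dagger$ is the Moore–Penrose pseudoinverse. Let $(\bar{\mathbf A},\bar{\mathbf B},\bar{\mathbf C})$ and $(\hat{\mathbf A},\hat{\mathbf B},\hat{\mathbf C})$ be any outputs of this algorithm (for any choice of the decompositions) with inputs $\mathbf H$ and $\hat{\mathbf H}$, respectively. Let $\mathbf L$ be the best approximation of $\mathbf H^-$ of rank at most $n$, and let $\sigma_{\min}(\mathbf L)$ be its $n$-th largest singular value. Write $\|\cdot\|$ for the spectral norm and $\|\cdot\|_F$ for the Frobenius norm. If $$\sigma_{\min}(\mathbf L)>0\qquad\text{and}\qquad \|\mathbf G-\hat{\mathbf G}\|_F\le\frac{\sigma_{\min}(\mathbf L)}{2\sqrt{2L}},$$ then there is an orthogonal (real unitary) matrix $\mathbf T\in\mathbb R^{n\times n}$ such that both $$\max\{\|\bar{\mathbf B}-\mathbf T^*\hat{\mathbf B}\|_F,\ \|\bar{\mathbf C}-\hat{\mathbf C}\mathbf T\|_F\}\le\sqrt{\frac{L}{\sigma_{\min}(\mathbf L)}}\;\|\mathbf G-\hat{\mathbf G}\|_F,$$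 $$\|\bar{\mathbf A}-\mathbf T^*\hat{\mathbf A}\mathbf T\|_F\le\sqrt L\left(\frac{\|\mathbf H\|+\|\hat{\mathbf H}\|}{\sigma_{\min}(\mathbf L)^2}+\frac1{\sigma_{\min}(\mathbf L)}\right)\|\mathbf G-\hat{\mathbf G}\|_F.$$ -/

import Mathlib

noncomputable section

namespace HoKalman

/-- The Frobenius norm of a real matrix. -/
def frobNorm {m k : Type*} [Fintype m] [Fintype k] (M : Matrix m k ℝ) : ℝ :=
  @Norm.norm (Matrix m k ℝ) Matrix.frobeniusNormedAddCommGroup.toNorm M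

/-- The spectral norm (Euclidean operator norm) of a real matrix. -/
def specNorm {m k : Type*} [Fintype m] [Fintype k] [DecidableEq k] (M : Matrix m k ℝ) : ℝ :=
  @Norm.norm (Matrix m k ℝ) Matrix.instL2OpNormedAddCommGroup.toNorm M

/-- The `n`-th largest singular value of a real matrix, counted from `1` and with multiplicity.
Mathlib's sequence `LinearMap.singularValues` is decreasing and counts from `0`. -/
def nthSingularValue (n : ℕ) {m k : Type*} [Fintype m] [Fintype k] [DecidableEq k]
    (M : Matrix m k ℝ) : ℝ :=
  (Matrix.toEuclideanLin M).singularValues (n - 1)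

/-- The block row `[B, A B, ..., A ^ (k - 1) B]`; the column `(j, b)` is the column `b` of the
`j`-th block. -/
def controllabilityMatrix {n p : ℕ} (A : Matrix (Fin n) (Fin n) ℝ) (B : Matrix (Fin n) (Fin p) ℝ)
    (k : ℕ) : Matrix (Fin n) (Fin k × Fin p) ℝ :=
  Matrix.of fun i c => (A ^ (c.1 : ℕ) * B) i c.2

/-- The block column `[C; C A; ...; C A ^ (k - 1)]`; the row `(i, a)` is the row `a` of the
`i`-th block. -/
def observabilityMatrix {n p : ℕ} (A : Matrix (Fin n) (Fin n) ℝ) (C : Matrix (Fin p) (Fin n) ℝ)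
    (k : ℕ) : Matrix (Fin k × Fin p) (Fin n) ℝ :=
  Matrix.of fun r j => (C * A ^ (r.1 : ℕ)) r.2 j

/-- The pair `(A, B)` is controllable (Kalman's rank criterion). -/
def IsControllable {n p : ℕ} (A : Matrix (Fin n) (Fin n) ℝ) (B : Matrix (Fin n) (Fin p) ℝ) : Prop :=
  (controllabilityMatrix A B n).rank = n

/-- The pair `(A, C)` is observable (Kalman's rank criterion). -/
def IsObservable {n p : ℕ} (A : Matrix (Fin n) (Fin n) ℝ) (C : Matrix (Fin p) (Fin n) ℝ) : Prop :=
  (observabilityMatrix A C n).rank = n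

/-- The matrix `G = [C B, C A B, ..., C A ^ (L - 1) B]` of the first `L` Markov parameters. -/
def markovMatrix {n p : ℕ} (A : Matrix (Fin n) (Fin n) ℝ) (B : Matrix (Fin n) (Fin p) ℝ)
    (C : Matrix (Fin p) (Fin n) ℝ) (L : ℕ) : Matrix (Fin p) (Fin L × Fin p) ℝ :=
  Matrix.of fun a c => (C * A ^ (c.1 : ℕ) * B) a c.2

/-- The clipped Hankel matrix `H = O Q` of the system, where `O = [C; C A; ...; C A ^ (L/2 - 1)]`
and `Q = [B, A B, ..., A ^ (L/2) B]`. -/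
def clippedHankel {n p : ℕ} (A : Matrix (Fin n) (Fin n) ℝ) (B : Matrix (Fin n) (Fin p) ℝ)
    (C : Matrix (Fin p) (Fin n) ℝ) (L : ℕ) :
    Matrix (Fin (L / 2) × Fin p) (Fin (L / 2 + 1) × Fin p) ℝ :=
  observabilityMatrix A C (L / 2) * controllabilityMatrix A B (L / 2 + 1)

/-- The clipped block Hankel matrix constructed from a matrix `G = [G₀, ..., G_{L-1}]` of `p × p`
blocks: its block in position `(i, j)` is `G_{i+j}`. -/
def hankelOf {p L : ℕ} (G : Matrix (Fin p) (Fin L × Fin p) ℝ) :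
    Matrix (Fin (L / 2) × Fin p) (Fin (L / 2 + 1) × Fin p) ℝ :=
  Matrix.of fun r c => G r.2 (⟨(r.1 : ℕ) + (c.1 : ℕ), by omega⟩, c.2)

/-- The clipped Hankel matrix of a system is the one constructed from its Markov parameters. -/
theorem clippedHankel_eq_hankelOf {n p : ℕ} (A : Matrix (Fin n) (Fin n) ℝ)
    (B : Matrix (Fin n) (Fin p) ℝ) (C : Matrix (Fin p) (Fin n) ℝ) (L : ℕ) :
    clippedHankel A B C L = hankelOf (markovMatrix A B C L) := by
  ext r c
  have h : C * A ^ ((r.1 : ℕ) + (c.1 : ℕ)) * B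
      = (C * A ^ (r.1 : ℕ)) * (A ^ (c.1 : ℕ) * B) := by
    simp only [pow_add, Matrix.mul_assoc]
  simp only [hankelOf, markovMatrix, Matrix.of_apply, h]
  rfl

/-- `H⁻`: the last block column (that is, the last `p` columns) of `H` is deleted. -/
def hankelMinus {p k : ℕ} (H : Matrix (Fin k × Fin p) (Fin (k + 1) × Fin p) ℝ) :
    Matrix (Fin k × Fin p) (Fin k × Fin p) ℝ :=
  H.submatrix id (fun c => (c.1.castSucc, c.2))

/-- `H⁺`: the first block column (that is, the first `p` columns) of `H` is deleted. -/
def hankelPlus {p k : ℕ} (H : Matrix (Fin k × Fin p) (Fin (k + 1) × Fin p) ℝ) :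
    Matrix (Fin k × Fin p) (Fin k × Fin p) ℝ :=
  H.submatrix id (fun c => (c.1.succ, c.2))

/-- `K` is a best approximation of `M` of rank at most `n` in the Frobenius norm. -/
def IsBestRankApprox {m k : Type*} [Fintype m] [Fintype k] (n : ℕ) (M K : Matrix m k ℝ) : Prop :=
  K.rank ≤ n ∧ ∀ N : Matrix m k ℝ, N.rank ≤ n → frobNorm (M - K) ≤ frobNorm (M - N)

/-- `M = U Σ Vᵀ` is a (thin) singular value decomposition with `n` singular values: `U` and `V` have
orthonormal columns and `Σ = diag s` with `s ≥ 0`. No order of the singular values is imposed. -/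
structure IsThinSVD {m k : Type*} [Fintype m] [Fintype k] {n : ℕ} (M : Matrix m k ℝ)
    (U : Matrix m (Fin n) ℝ) (s : Fin n → ℝ) (V : Matrix k (Fin n) ℝ) : Prop where
  orth_left : U.transpose * U = 1
  orth_right : V.transpose * V = 1
  nonneg : ∀ i, 0 ≤ s i
  eq_mul : M = U * Matrix.diagonal s * V.transpose

/-- `X` is the Moore-Penrose pseudoinverse of the real matrix `M`. -/
structure IsPseudoinverse {m k : Type*} [Fintype m] [Fintype k]
    (M : Matrix m k ℝ) (X : Matrix k m ℝ) : Prop where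
  mul_mul_self : M * X * M = M
  mul_mul_inv : X * M * X = X
  symm_left : (M * X).transpose = M * X
  symm_right : (X * M).transpose = X * M

/-- `(A, B, C)` is an output of the Ho-Kalman algorithm of order `n` with input the clipped Hankel
matrix `H`, which has `k` block rows and `k + 1` block columns of size `p × p`:
* `K` is the rank-`n` approximation of `H⁻` and `K = U Σ Vᵀ` a singular value decomposition;
* `O = U Σ^{1/2}` and `Q = Σ^{1/2} Vᵀ`;
* `C` consists of the first `p` rows of `O`, `B` of the first `p` columns of `Q`,
  and `A = O† H⁺ Q†`.
A singular value decomposition is not unique, so this is a relation. -/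
def IsHoKalmanOutput (n : ℕ) {p k : ℕ} (hk : 0 < k)
    (H : Matrix (Fin k × Fin p) (Fin (k + 1) × Fin p) ℝ)
    (A : Matrix (Fin n) (Fin n) ℝ) (B : Matrix (Fin n) (Fin p) ℝ)
    (C : Matrix (Fin p) (Fin n) ℝ) : Prop :=
  ∃ (K : Matrix (Fin k × Fin p) (Fin k × Fin p) ℝ)
    (U : Matrix (Fin k × Fin p) (Fin n) ℝ) (s : Fin n → ℝ) (V : Matrix (Fin k × Fin p) (Fin n) ℝ)
    (O : Matrix (Fin k × Fin p) (Fin n) ℝ) (Q : Matrix (Fin n) (Fin k × Fin p) ℝ)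
    (Odag : Matrix (Fin n) (Fin k × Fin p) ℝ) (Qdag : Matrix (Fin k × Fin p) (Fin n) ℝ),
    IsBestRankApprox n (hankelMinus H) K ∧
    IsThinSVD K U s V ∧
    O = U * Matrix.diagonal (fun i => Real.sqrt (s i)) ∧
    Q = Matrix.diagonal (fun i => Real.sqrt (s i)) * V.transpose ∧
    IsPseudoinverse O Odag ∧
    IsPseudoinverse Q Qdag ∧
    C = O.submatrix (fun a => (⟨0, hk⟩, a)) id ∧
    B = Q.submatrix id (fun b => (⟨0, hk⟩, b)) ∧
    A = Odag * hankelPlus H * Qdag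

end HoKalman

end

/-! Write `σ` for the `n`-th singular value of `L`, `d` for `‖Ĥ - H‖_F` and `e` for `‖K̂ - L‖_F`,
where `K̂` is the truncation of `Ĥ⁻`. Since `H⁻` factors through `ℝⁿ`, it is its own best
approximation, so `L = H⁻` and the exact output is read off a balanced factorization `L = O Q` with
`Oᵀ O = Q Qᵀ = Σ`. A block of `G` occurs at most once in each block row of `H`, so `2 d² ≤ L ‖G -
Ĝ‖_F²`, and the hypothesis gives `d ≤ σ / 4`.

Truncation. The triangle inequality only gives `e ≤ 2 d`, too weak for the constants below. The
residual of `K̂` is orthogonal to its singular subspaces, and the part of `L` normal to both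
subspaces has size at most `e² / σ`. Expanding `‖Ĥ⁻ - L‖_F²` yields `e² ≤ d² + e⁴ / σ²`, hence `3 e²
≤ 4 d²` (`IsBestRankApprox.three_mul_frobNorm_sub_sq_le`). Weyl's inequality then keeps the singular
values of `K̂` above `0.71 σ`.

Alignment. An orthogonal `T` is chosen by polar decomposition to align both balanced factors at
once. Trace inequalities for Gram matrices bound the total squared factor error `x` by `σ x ≤ 1.41
d²` (`exists_orthogonal_procrustes`, `procrustes_scalar_bound`). The errors of `B` and `C` are
submatrices of the factor errors.

State matrix. The exact `Ā` solves `H⁺ = O Ā Q`, so `Ā - Tᵀ Â T` expands in the factor errors and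
`Ĥ⁺ - H⁺` (`frobNorm_sub_pinv_mul_le`); `realization_scalar_bound` fits the constants. -/

namespace HoKalman

open Matrix WithLp

/-! ### Frobenius and spectral norms. -/

section Norms

variable {l m k : Type*} [Fintype l] [Fintype m] [Fintype k]

theorem frobNorm_nonneg (M : Matrix m k ℝ) : 0 ≤ frobNorm M :=
  @norm_nonneg _ Matrix.frobeniusNormedAddCommGroup.toSeminormedAddCommGroup.toSeminormedAddGroup M

theorem frobNorm_add_le (M N : Matrix m k ℝ) : frobNorm (M + N) ≤ frobNorm M + frobNorm N :=
  @norm_add_le _ Matrix.frobeniusNormedAddCommGroup.toSeminormedAddCommGroup.toSeminormedAddGroup M N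

theorem frobNorm_neg (M : Matrix m k ℝ) : frobNorm (-M) = frobNorm M :=
  @norm_neg _ Matrix.frobeniusNormedAddCommGroup.toSeminormedAddCommGroup.toSeminormedAddGroup M

theorem frobNorm_sub_le (M N : Matrix m k ℝ) : frobNorm (M - N) ≤ frobNorm M + frobNorm N := by
  rw [sub_eq_add_neg, ← frobNorm_neg N]
  exact frobNorm_add_le _ _

theorem frobNorm_sub_rev (M N : Matrix m k ℝ) : frobNorm (M - N) = frobNorm (N - M) := by
  rw [← frobNorm_neg, neg_sub]

theorem frobNorm_mul_le (M : Matrix l m ℝ) (N : Matrix m k ℝ) :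
    frobNorm (M * N) ≤ frobNorm M * frobNorm N :=
  Matrix.frobenius_norm_mul M N

theorem frobNorm_transpose (M : Matrix m k ℝ) : frobNorm Mᵀ = frobNorm M :=
  Matrix.frobenius_norm_transpose M

theorem frobNorm_sq_eq_sum (M : Matrix m k ℝ) : frobNorm M ^ 2 = ∑ i, ∑ j, M i j ^ 2 := by
  have h : 0 ≤ ∑ i, ∑ j, M i j ^ 2 := by positivity
  rw [frobNorm, Matrix.frobenius_norm_def, ← Real.rpow_natCast, ← Real.rpow_mul (by positivity)]
  simp

theorem frobNorm_sq (M : Matrix m k ℝ) : frobNorm M ^ 2 = (Mᵀ * M).trace := by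
  rw [frobNorm_sq_eq_sum, Finset.sum_comm]
  simp [Matrix.trace, Matrix.mul_apply, sq]

theorem frobNorm_sq' (M : Matrix m k ℝ) : frobNorm M ^ 2 = (M * Mᵀ).trace := by
  rw [frobNorm_sq, Matrix.trace_mul_comm]

theorem frobNorm_sq_eq_sum_norm (M : Matrix m k ℝ) :
    frobNorm M ^ 2 = ∑ j, ‖toLp 2 (M.col j)‖ ^ 2 := by
  rw [frobNorm_sq_eq_sum, Finset.sum_comm]
  simp [EuclideanSpace.norm_sq_eq]

theorem sum_comp_le_sum_of_injective {ι κ : Type*} [Fintype ι] [Fintype κ] {f : κ → ℝ}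
    (hf : ∀ i, 0 ≤ f i) {g : ι → κ} (hg : g.Injective) : ∑ i, f (g i) ≤ ∑ i, f i := by
  have h := Finset.sum_map Finset.univ ⟨g, hg⟩ f
  simp only [Function.Embedding.coeFn_mk] at h
  rw [← h]
  exact Finset.sum_le_univ_sum_of_nonneg hf

theorem frobNorm_submatrix_le {m' k' : Type*} [Fintype m'] [Fintype k'] (M : Matrix m k ℝ)
    {f : m' → m} {g : k' → k} (hf : f.Injective) (hg : g.Injective) :
    frobNorm (M.submatrix f g) ≤ frobNorm M := by
  refine le_of_sq_le_sq ?_ (frobNorm_nonneg _)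
  rw [frobNorm_sq_eq_sum, frobNorm_sq_eq_sum]
  calc ∑ i, ∑ j, M.submatrix f g i j ^ 2
      ≤ ∑ i, ∑ j, M (f i) j ^ 2 := Finset.sum_le_sum fun i _ =>
        sum_comp_le_sum_of_injective (f := fun j => M (f i) j ^ 2) (fun _ => by positivity) hg
    _ ≤ ∑ i, ∑ j, M i j ^ 2 :=
        sum_comp_le_sum_of_injective (f := fun i => ∑ j, M i j ^ 2) (fun _ => by positivity) hf

theorem two_mul_trace_le (M N : Matrix m k ℝ) :
    2 * (Mᵀ * N).trace ≤ frobNorm M ^ 2 + frobNorm N ^ 2 := by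
  have h := sq_nonneg (frobNorm (M - N))
  have h' : (Nᵀ * M).trace = (Mᵀ * N).trace := by
    rw [← Matrix.trace_transpose, transpose_mul, transpose_transpose]
  rw [frobNorm_sq] at h ⊢
  rw [frobNorm_sq]
  simp only [transpose_sub, Matrix.sub_mul, Matrix.mul_sub, trace_sub] at h
  linarith

variable [DecidableEq k]

theorem specNorm_nonneg (M : Matrix m k ℝ) : 0 ≤ specNorm M :=
  @norm_nonneg _ Matrix.instL2OpNormedAddCommGroup.toSeminormedAddCommGroup.toSeminormedAddGroup M

theorem specNorm_add_le (M N : Matrix m k ℝ) : specNorm (M + N) ≤ specNorm M + specNorm N :=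
  @norm_add_le _ Matrix.instL2OpNormedAddCommGroup.toSeminormedAddCommGroup.toSeminormedAddGroup M N

theorem specNorm_mul_le [DecidableEq m] (M : Matrix l m ℝ) (N : Matrix m k ℝ) :
    specNorm (M * N) ≤ specNorm M * specNorm N :=
  Matrix.l2_opNorm_mul M N

theorem specNorm_transpose [DecidableEq m] (M : Matrix m k ℝ) : specNorm Mᵀ = specNorm M := by
  rw [← conjTranspose_eq_transpose_of_trivial]
  exact Matrix.l2_opNorm_conjTranspose M

theorem norm_mulVec_le (M : Matrix m k ℝ) (x : k → ℝ) :
    ‖toLp 2 (M *ᵥ x)‖ ≤ specNorm M * ‖toLp 2 x‖ :=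
  Matrix.l2_opNorm_mulVec M (toLp 2 x)

theorem specNorm_le {M : Matrix m k ℝ} {c : ℝ} (hc : 0 ≤ c)
    (h : ∀ x : k → ℝ, ‖toLp 2 (M *ᵥ x)‖ ≤ c * ‖toLp 2 x‖) : specNorm M ≤ c := by
  rw [specNorm, Matrix.l2_opNorm_def]
  exact ContinuousLinearMap.opNorm_le_bound _ hc fun x => h (ofLp x)

theorem specNorm_diagonal (s : k → ℝ) : specNorm (diagonal s) = ‖s‖ :=
  Matrix.l2_opNorm_diagonal s

theorem norm_mulVec_of_transpose_mul_self {Y : Matrix m k ℝ} (hY : Yᵀ * Y = 1)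
    (z : k → ℝ) : ‖toLp 2 (Y *ᵥ z)‖ = ‖toLp 2 z‖ := by
  have : ‖toLp 2 (Y *ᵥ z)‖ ^ 2 = ‖toLp 2 z‖ ^ 2 := by
    simp only [EuclideanSpace.real_norm_sq_eq]
    have h2 : (Y *ᵥ z) ⬝ᵥ (Y *ᵥ z) = z ⬝ᵥ z := by
      rw [Matrix.dotProduct_mulVec, ← Matrix.mulVec_transpose, Matrix.mulVec_mulVec, hY, one_mulVec]
    simpa [dotProduct, sq] using h2
  exact (pow_left_inj₀ (norm_nonneg _) (norm_nonneg _) two_ne_zero).mp this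

theorem specNorm_le_one_of_transpose_mul_self {M : Matrix m k ℝ} (h : Mᵀ * M = 1) :
    specNorm M ≤ 1 :=
  specNorm_le zero_le_one fun x => by rw [norm_mulVec_of_transpose_mul_self h, one_mul]

omit [DecidableEq k] in
-- The squared Frobenius norm is the sum of the squared column norms, and `M` acts on each column of
-- `N` separately.
theorem frobNorm_mul_le_specNorm_mul [DecidableEq m] (M : Matrix l m ℝ) (N : Matrix m k ℝ) :
    frobNorm (M * N) ≤ specNorm M * frobNorm N := by
  refine le_of_sq_le_sq ?_ (mul_nonneg (specNorm_nonneg _) (frobNorm_nonneg _))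
  rw [mul_pow, frobNorm_sq_eq_sum_norm, frobNorm_sq_eq_sum_norm, Finset.mul_sum]
  refine Finset.sum_le_sum fun j _ => ?_
  rw [← mul_pow]
  exact pow_le_pow_left₀ (norm_nonneg _) (norm_mulVec_le M (N.col j)) 2

theorem frobNorm_mul_le_mul_specNorm [DecidableEq l] [DecidableEq m] (M : Matrix l m ℝ) (N : Matrix m k ℝ) :
    frobNorm (M * N) ≤ frobNorm M * specNorm N := by
  rw [← frobNorm_transpose, transpose_mul, ← frobNorm_transpose M, ← specNorm_transpose N, mul_comm]
  exact frobNorm_mul_le_specNorm_mul _ _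

theorem specNorm_le_frobNorm (M : Matrix m k ℝ) : specNorm M ≤ frobNorm M := by
  refine specNorm_le (frobNorm_nonneg _) fun x => ?_
  have h := frobNorm_mul_le M (replicateCol Unit x)
  rw [← Matrix.replicateCol_mulVec] at h
  simpa only [frobNorm, Matrix.frobenius_norm_replicateCol] using h

theorem specNorm_sub_le_frobNorm_add (M N : Matrix m k ℝ) :
    specNorm M ≤ frobNorm (M - N) + specNorm N := by
  calc specNorm M = specNorm ((M - N) + N) := by rw [sub_add_cancel]
    _ ≤ _ := (specNorm_add_le _ _).trans (by gcongr; exact specNorm_le_frobNorm _)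

theorem specNorm_submatrix_right_le {k' : Type*} [Fintype k'] [DecidableEq k'] (M : Matrix m k ℝ)
    {g : k' → k} (hg : g.Injective) : specNorm (M.submatrix id g) ≤ specNorm M := by
  -- Selecting columns is multiplication by a selection matrix, whose columns are orthonormal
  -- because `g` is injective.
  have h : M.submatrix id g = M * (1 : Matrix k k ℝ).submatrix id g := by
    ext i j
    simp [Matrix.mul_apply, Matrix.one_apply]
  have h1 : ((1 : Matrix k k ℝ).submatrix id g)ᵀ * (1 : Matrix k k ℝ).submatrix id g = 1 := by
    ext i j
    simp [Matrix.mul_apply, Matrix.one_apply, hg.eq_iff, eq_comm]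
  rw [h]
  refine (specNorm_mul_le _ _).trans ?_
  exact mul_le_of_le_one_right (specNorm_nonneg _) (specNorm_le_one_of_transpose_mul_self h1)

end Norms

/-! ### Polar decomposition. -/

/-- Polar decomposition of a square matrix. -/
theorem exists_orthogonal_mul_posSemidef {n : Type*} [Fintype n] [DecidableEq n]
    (M : Matrix n n ℝ) : ∃ T ∈ Matrix.orthogonalGroup n ℝ, (M * T).PosSemidef := by
  have hM : (Mᴴ * M).IsHermitian := isHermitian_conjTranspose_mul_self M
  set v := hM.eigenvectorBasis with hv
  set lam := hM.eigenvalues with hl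
  have hlam : ∀ i, 0 ≤ lam i := (posSemidef_conjTranspose_mul_self M).eigenvalues_nonneg
  have hin : ∀ i j, inner ℝ (toLp 2 (M *ᵥ v i)) (toLp 2 (M *ᵥ v j))
      = if i = j then lam j else 0 := by
    intro i j
    have h0 : Mᵀ *ᵥ (M *ᵥ v j) = lam j • ofLp (v j) := by
      rw [Matrix.mulVec_mulVec, ← conjTranspose_eq_transpose_of_trivial]
      exact hM.mulVec_eigenvectorBasis j
    have h1 : inner ℝ (toLp 2 (M *ᵥ v i)) (toLp 2 (M *ᵥ v j))
        = lam j * inner ℝ (v i) (v j) := by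
      simp only [EuclideanSpace.inner_eq_star_dotProduct, star_trivial]
      rw [Matrix.dotProduct_mulVec, ← Matrix.mulVec_transpose, h0, smul_dotProduct, smul_eq_mul]
    rw [h1, orthonormal_iff_ite.mp v.orthonormal i j]
    simp
  -- The images of the eigenvectors of `Mᴴ M` are pairwise orthogonal. The nonzero ones are
  -- normalized and extended to an orthonormal basis, so a singular `M` needs no separate treatment.
  obtain ⟨u, hu⟩ := Orthonormal.exists_orthonormalBasis_extension_of_card_eq (𝕜 := ℝ)
    (E := EuclideanSpace ℝ n) (ι := n) (by simp)
    (v := fun i => (√(lam i))⁻¹ • toLp 2 (M *ᵥ v i)) (s := {i | 0 < lam i}) (by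
      rw [orthonormal_iff_ite]
      rintro ⟨i, hi⟩ ⟨j, hj⟩
      have hi' : 0 < lam i := hi
      simp only [Set.domRestrict_apply, inner_smul_left, inner_smul_right, hin, Subtype.mk.injEq]
      split_ifs with hij
      · subst hij
        have h2 := Real.mul_self_sqrt hi'.le
        have h3 := (Real.sqrt_pos.mpr hi').ne'
        simp only [conj_trivial]
        field_simp
        nlinarith
      · simp)
  have hMv : ∀ i, M *ᵥ v i = √(lam i) • ofLp (u i) := by
    intro i
    rcases (hlam i).eq_or_lt with h | h
    · have h2 := hin i i
      rw [if_pos rfl, ← h, inner_self_eq_zero] at h2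
      rw [← h, Real.sqrt_zero, zero_smul]
      simpa using h2
    · rw [hu i h]
      simp [smul_smul, (Real.sqrt_pos.mpr h).ne']
  have horth : ∀ b : OrthonormalBasis n ℝ (EuclideanSpace ℝ n),
      (Matrix.of fun i j => b j i)ᵀ * (Matrix.of fun i j => b j i) = 1 := by
    intro b
    ext i j
    have := orthonormal_iff_ite.mp b.orthonormal i j
    rw [EuclideanSpace.inner_eq_star_dotProduct] at this
    simpa [Matrix.mul_apply, Matrix.one_apply, dotProduct, mul_comm] using this
  set V : Matrix n n ℝ := Matrix.of fun i j => v j i with hV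
  set U : Matrix n n ℝ := Matrix.of fun i j => u j i with hU
  have hMV : M * V = U * diagonal fun i => √(lam i) := by
    ext i j
    have := congrFun (hMv j) i
    rw [Matrix.mul_diagonal, Matrix.mul_apply]
    simpa [Matrix.mulVec, dotProduct, hV, hU, mul_comm] using this
  have hVV : V * Vᵀ = 1 := mul_eq_one_comm.mp (horth v)
  -- From `M V = U √Λ`, this choice gives `M T = U √Λ Uᵀ`.
  refine ⟨V * Uᵀ, ?_, ?_⟩
  · rw [Matrix.mem_orthogonalGroup_iff, transpose_mul, transpose_transpose, Matrix.mul_assoc,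
      ← Matrix.mul_assoc Uᵀ, horth u, Matrix.one_mul, hVV]
  · rw [← Matrix.mul_assoc, hMV]
    have := (PosSemidef.diagonal (n := n) (d := fun i => √(lam i))
      (fun i => Real.sqrt_nonneg _)).mul_mul_conjTranspose_same U
    rwa [conjTranspose_eq_transpose_of_trivial] at this

/-! ### Variational bounds for singular values. -/

section SVD

variable {m k : Type*} [Fintype m] [Fintype k] [DecidableEq k] {n : ℕ}

/-- Courant-Fischer: a lower bound of `M` on an `n`-dimensional subspace bounds the singular values
of a thin decomposition of `M` from below. -/
theorem IsThinSVD.le_of_forall_le_norm_mulVec {M : Matrix m k ℝ} {U : Matrix m (Fin n) ℝ}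
    {s : Fin n → ℝ} {V : Matrix k (Fin n) ℝ} (h : IsThinSVD M U s V) {Y : Matrix k (Fin n) ℝ}
    (hY : Yᵀ * Y = 1) {τ : ℝ} (hτ : ∀ z : Fin n → ℝ, τ * ‖toLp 2 z‖ ≤ ‖toLp 2 (M *ᵥ (Y *ᵥ z))‖)
    (i : Fin n) : τ ≤ s i := by
  -- Erasing row `i` of the square matrix `Vᵀ Y` makes it singular. A kernel vector `z` gives `Y z`
  -- no component along any right singular vector except possibly the `i`-th, so only `s i` enters
  -- `M Y z`. No ordering of `s` is needed.
  obtain ⟨z, hz0, hz⟩ : ∃ z ≠ 0, (Vᵀ * Y).updateRow i 0 *ᵥ z = 0 :=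
    Matrix.exists_mulVec_eq_zero_iff.mpr (Matrix.det_eq_zero_of_row_eq_zero i (by simp))
  set W := Vᵀ * Y with hW
  have hWz : W *ᵥ z = Pi.single i ((W *ᵥ z) i) := by
    ext j
    rcases eq_or_ne j i with rfl | hj
    · simp
    · have := congrFun hz j
      simp only [Matrix.mulVec, Matrix.updateRow_ne hj, Pi.zero_apply] at this
      rw [Pi.single_eq_of_ne hj]
      exact this
  have hMY : M *ᵥ (Y *ᵥ z) = U *ᵥ Pi.single i (s i * (W *ᵥ z) i) := by
    rw [h.eq_mul, Matrix.mulVec_mulVec, Matrix.mul_assoc, ← hW, ← Matrix.mulVec_mulVec, hWz,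
      ← Matrix.mulVec_mulVec, Matrix.diagonal_mulVec_single, Pi.single_eq_same]
  have hpos : 0 < ‖toLp 2 z‖ := norm_pos_iff.mpr (by simpa using hz0)
  have h1 : ‖toLp 2 (M *ᵥ (Y *ᵥ z))‖ ≤ s i * |(W *ᵥ z) i| := by
    rw [hMY]
    refine (norm_mulVec_le _ _).trans ?_
    have h2 : ‖toLp 2 (Pi.single i (s i * (W *ᵥ z) i) : Fin n → ℝ)‖ = s i * |(W *ᵥ z) i| := by
      rw [PiLp.toLp_single, PiLp.norm_single, Real.norm_eq_abs, abs_mul,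
        abs_of_nonneg (h.nonneg i)]
    rw [h2]
    exact mul_le_of_le_one_left (mul_nonneg (h.nonneg i) (abs_nonneg _))
      (specNorm_le_one_of_transpose_mul_self h.orth_left)
  have h3 : |(W *ᵥ z) i| ≤ ‖toLp 2 z‖ := by
    have h4 : ‖toLp 2 (W *ᵥ z)‖ = |(W *ᵥ z) i| := by
      rw [hWz, PiLp.toLp_single, PiLp.norm_single, Real.norm_eq_abs,
        Pi.single_eq_same]
    rw [← h4]
    refine (norm_mulVec_le _ _).trans (mul_le_of_le_one_left (norm_nonneg _) ?_)
    refine (specNorm_mul_le _ _).trans ?_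
    rw [specNorm_transpose]
    exact mul_le_one₀ (specNorm_le_one_of_transpose_mul_self h.orth_right) (specNorm_nonneg _)
      (specNorm_le_one_of_transpose_mul_self hY)
  refine le_of_mul_le_mul_right ?_ hpos
  exact (hτ z).trans (h1.trans (mul_le_mul_of_nonneg_left h3 (h.nonneg i)))

theorem mul_norm_le_norm_diagonal_mulVec {s : Fin n → ℝ} {τ : ℝ} (hτ : 0 ≤ τ) (hs : ∀ i, τ ≤ s i)
    (z : Fin n → ℝ) : τ * ‖toLp 2 z‖ ≤ ‖toLp 2 (diagonal s *ᵥ z)‖ := by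
  refine le_of_sq_le_sq ?_ (norm_nonneg _)
  rw [mul_pow, EuclideanSpace.real_norm_sq_eq, EuclideanSpace.real_norm_sq_eq, Finset.mul_sum]
  refine Finset.sum_le_sum fun i _ => ?_
  simp only [Matrix.mulVec_diagonal, mul_pow]
  gcongr
  exact hs i

/-- The span of the first `n` right singular vectors. -/
theorem exists_orthonormal_nthSingularValue_le (M : Matrix m k ℝ) (hn : n - 1 < Fintype.card k)
    (hn' : 1 ≤ n) : ∃ (Y : Matrix k (Fin n) ℝ) (c : Fin n → ℝ), Yᵀ * Y = 1 ∧
      (M * Y)ᵀ * (M * Y) = diagonal c ∧ ∀ i, nthSingularValue n M ^ 2 ≤ c i := by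
  set f := Matrix.toEuclideanLin M with hf
  have hN : Module.finrank ℝ (EuclideanSpace ℝ k) = Fintype.card k := finrank_euclideanSpace
  have hnN : n ≤ Fintype.card k := by omega
  set b := f.isSymmetric_adjoint_comp_self.eigenvectorBasis hN with hb
  set lam := f.isSymmetric_adjoint_comp_self.eigenvalues hN with hlam
  have hin := orthonormal_iff_ite.mp b.orthonormal
  refine ⟨Matrix.of fun a j => b (Fin.castLE hnN j) a, fun j => lam (Fin.castLE hnN j),
    ?_, ?_, ?_⟩
  · ext j l
    have h1 : inner ℝ (b (Fin.castLE hnN l)) (b (Fin.castLE hnN j))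
        = if j = l then 1 else 0 := by
      rw [hin]
      simp only [Fin.castLE_inj, eq_comm]
    rw [one_apply, ← h1]
    rfl
  · ext j l
    have h1 : inner ℝ (f (b (Fin.castLE hnN l))) (f (b (Fin.castLE hnN j)))
        = if j = l then lam (Fin.castLE hnN j) else 0 := by
      have h2 := f.isSymmetric_adjoint_comp_self.apply_eigenvectorBasis hN (Fin.castLE hnN j)
      rw [← LinearMap.adjoint_inner_right, ← LinearMap.comp_apply, h2, inner_smul_right, hin]
      simp only [Fin.castLE_inj, eq_comm (a := j), mul_ite, mul_one, mul_zero]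
      rfl
    rw [diagonal_apply, ← h1]
    rfl
  · intro j
    rw [nthSingularValue, f.sq_singularValues_of_lt hN hn]
    refine f.isSymmetric_adjoint_comp_self.eigenvalues_antitone hN ?_
    rw [Fin.le_def]
    simp only [Fin.val_castLE]
    omega

/-- The entries of `s` are unordered, so the bound is needed for every index. It follows by testing
on the span of the first `n` right singular vectors. -/
theorem IsThinSVD.nthSingularValue_le {M : Matrix m k ℝ} {U : Matrix m (Fin n) ℝ}
    {s : Fin n → ℝ} {V : Matrix k (Fin n) ℝ} (h : IsThinSVD M U s V)
    (hn : 1 ≤ n) (i : Fin n) : nthSingularValue n M ≤ s i := by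
  -- Beyond the dimension of the domain, the singular value sequence takes the value `0`.
  rcases le_or_gt (Fintype.card k) (n - 1) with hle | hlt
  · rw [nthSingularValue, LinearMap.singularValues_of_finrank_le]
    · exact h.nonneg i
    · rwa [finrank_euclideanSpace]
  obtain ⟨Y, c, hY, hMY, hc⟩ := exists_orthonormal_nthSingularValue_le M hlt hn
  refine h.le_of_forall_le_norm_mulVec hY (fun z => ?_) i
  refine le_of_sq_le_sq ?_ (norm_nonneg _)
  have h4 : ((M * Y) *ᵥ z) ⬝ᵥ ((M * Y) *ᵥ z) = (diagonal c *ᵥ z) ⬝ᵥ z := by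
    rw [Matrix.dotProduct_mulVec, ← Matrix.mulVec_transpose, Matrix.mulVec_mulVec, hMY]
  simp only [dotProduct, Matrix.mulVec_diagonal] at h4
  rw [Matrix.mulVec_mulVec, mul_pow, EuclideanSpace.real_norm_sq_eq,
    EuclideanSpace.real_norm_sq_eq, Finset.mul_sum]
  simp only [sq ((_ : ℝ)), h4]
  refine Finset.sum_le_sum fun j _ => ?_
  have := mul_le_mul_of_nonneg_right (hc j) (mul_self_nonneg (z j))
  linarith

/-- Weyl's inequality. -/
theorem IsThinSVD.sub_le {M M' : Matrix m k ℝ} {U U' : Matrix m (Fin n) ℝ}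
    {s s' : Fin n → ℝ} {V V' : Matrix k (Fin n) ℝ} (h : IsThinSVD M U s V)
    (h' : IsThinSVD M' U' s' V') {τ : ℝ} (hτ : 0 ≤ τ) (hs : ∀ i, τ ≤ s i) (i : Fin n) :
    τ - specNorm (M' - M) ≤ s' i := by
  -- The test subspace is spanned by the right singular vectors of `M`, on which `M` expands by at
  -- least `τ`.
  refine h'.le_of_forall_le_norm_mulVec h.orth_right (fun z => ?_) i
  have h1 : M *ᵥ (V *ᵥ z) = U *ᵥ (diagonal s *ᵥ z) := by
    rw [Matrix.mulVec_mulVec, h.eq_mul, Matrix.mul_assoc _ Vᵀ, h.orth_right, Matrix.mul_one,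
      Matrix.mulVec_mulVec]
  have h2 : toLp 2 (M *ᵥ (V *ᵥ z)) = toLp 2 (M' *ᵥ (V *ᵥ z)) - toLp 2 ((M' - M) *ᵥ (V *ᵥ z)) := by
    rw [← toLp_sub, Matrix.sub_mulVec, sub_sub_cancel]
  have h3 := norm_sub_le (toLp 2 (M' *ᵥ (V *ᵥ z))) (toLp 2 ((M' - M) *ᵥ (V *ᵥ z)))
  have h4 := norm_mulVec_le (M' - M) (V *ᵥ z)
  have h5 := mul_norm_le_norm_diagonal_mulVec hτ hs z
  rw [norm_mulVec_of_transpose_mul_self h.orth_right] at h4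
  rw [← h2, h1, norm_mulVec_of_transpose_mul_self h.orth_left] at h3
  linarith

end SVD

/-! ### Trace inequalities for Gram matrices. -/

section Trace

variable {n : Type*} [Fintype n] [DecidableEq n]

open scoped MatrixOrder Matrix.Norms.L2Operator in
-- With `A = Xᴴ X`, the trace equals that of the positive semidefinite matrix `X B Xᴴ`.
theorem trace_mul_nonneg {A B : Matrix n n ℝ} (hA : A.PosSemidef) (hB : B.PosSemidef) :
    0 ≤ (A * B).trace := by
  obtain ⟨X, rfl⟩ := CStarAlgebra.nonneg_iff_eq_star_mul_self.mp hA.nonneg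
  rw [Matrix.mul_assoc, Matrix.trace_mul_comm]
  exact (hB.mul_mul_conjTranspose_same X).trace_nonneg

/-- The two inequalities behind the orthogonal Procrustes bound, in terms of Gram matrices. -/
theorem procrustes_trace_bounds {α β S : Matrix n n ℝ} {τ x N : ℝ} (hα : α.IsHermitian)
    (hαG : τ * (α + β - (2:ℝ) • S).trace ≤ ((α + β - (2:ℝ) • S) * α).trace)
    (hS : S.PosSemidef) (hG : (α + β - (2:ℝ) • S).PosSemidef)
    (hx : (α + β - (2:ℝ) • S).trace = x)
    (hGx : ((α + β - (2:ℝ) • S) * (α + β - (2:ℝ) • S)).trace ≤ x ^ 2)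
    (hN : (α * α).trace + (β * β).trace - 2 * (S * S).trace ≤ N) :
    4 / 5 * τ * x ≤ N ∧ 2 * τ * x - x ^ 2 ≤ N := by
  set G := α + β - (2:ℝ) • S with hGdef
  have hβ : β = G + (2:ℝ) • S - α := by rw [hGdef]; abel
  have hGS := trace_mul_nonneg hG hS
  have hGG := trace_mul_nonneg hG hG
  have hGT : Gᵀ = G := by simpa using hG.isHermitian.eq
  have hST : Sᵀ = S := by simpa using hS.isHermitian.eq
  have hαT : αᵀ = α := by simpa using hα.eq
  have hsq : ∀ c : ℝ, 0 ≤ ((S - α + c • G) * (S - α + c • G)).trace := by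
    intro c
    have h := frobNorm_sq (S - α + c • G)
    rw [transpose_add, transpose_sub, transpose_smul, hGT, hST, hαT] at h
    rw [← h]
    positivity
  have e1 := Matrix.trace_mul_comm S G
  have e2 := Matrix.trace_mul_comm α G
  have e3 := Matrix.trace_mul_comm α S
  -- Eliminating `β`, the left side of `hN` is the trace of `2 (S - α)² + G² + 4 G S - 2 G α`.
  -- Bounding `(S - α)²` below through `hsq c` leaves `2 G α - G²` for `c = 1`, and `0.8 G α + 1.2 G
  -- S + 0.02 G²` for `c = 7/10`. The first is sharp for small `x`; the second has no negative term.
  have h1 := hsq 1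
  have h2 := hsq (7 / 10)
  rw [hβ] at hN
  simp only [Matrix.add_mul, Matrix.mul_add, Matrix.sub_mul, Matrix.mul_sub, Matrix.smul_mul,
    Matrix.mul_smul, trace_add, trace_sub, trace_smul, smul_eq_mul, e1, e2, e3] at h1 h2 hN
  rw [hx] at hαG
  constructor
  · linarith
  · linarith

end Trace

/-! ### Best approximations of bounded rank. -/

section BestApprox

variable {m k : Type*} [Fintype m] [Fintype k] {n : ℕ}

theorem frobNorm_eq_zero {M : Matrix m k ℝ} (h : frobNorm M ≤ 0) : M = 0 :=
  (@norm_eq_zero _ Matrix.frobeniusNormedAddCommGroup.toNormedAddGroup M).mp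
    (le_antisymm h (frobNorm_nonneg _))

theorem IsBestRankApprox.eq_of_rank_le {M K : Matrix m k ℝ} (h : IsBestRankApprox n M K)
    (hM : M.rank ≤ n) : K = M := by
  have h1 := h.2 M hM
  have h2 : frobNorm (M - M) = 0 := by
    rw [sub_self]
    exact @norm_zero _ Matrix.frobeniusNormedAddCommGroup.toSeminormedAddCommGroup.toSeminormedAddGroup
  exact (sub_eq_zero.mp (frobNorm_eq_zero (h1.trans h2.le))).symm

theorem frobNorm_add_sq_of_trace_eq_zero {M N : Matrix m k ℝ} (h : (Mᵀ * N).trace = 0) :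
    frobNorm (M + N) ^ 2 = frobNorm M ^ 2 + frobNorm N ^ 2 := by
  have h' : (Nᵀ * M).trace = 0 := by
    rw [← Matrix.trace_transpose, transpose_mul, transpose_transpose, h]
  simp only [frobNorm_sq, transpose_add, Matrix.add_mul, Matrix.mul_add, trace_add, h, h']
  ring

/-- The residual of a best approximation is orthogonal to the left singular vectors. -/
theorem IsBestRankApprox.transpose_mul_sub {M K : Matrix m k ℝ} (h : IsBestRankApprox n M K)
    {U : Matrix m (Fin n) ℝ} {X : Matrix (Fin n) k ℝ} (hU : Uᵀ * U = 1) (hK : K = U * X) :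
    Uᵀ * (M - K) = 0 := by
  -- The competitor is the projection of `M` onto the column space of `U`. By Pythagoras, `K` can be
  -- no worse only if it equals this projection.
  have h1 := h.2 (U * (Uᵀ * M)) ((Matrix.rank_mul_le_left _ _).trans
    ((Matrix.rank_le_card_width U).trans_eq (Fintype.card_fin n)))
  have h2 : Uᵀ * (M - U * (Uᵀ * M)) = 0 := by
    rw [Matrix.mul_sub, ← Matrix.mul_assoc, hU, Matrix.one_mul, sub_self]
  have h3 : frobNorm ((M - U * (Uᵀ * M)) + (U * (Uᵀ * M - X))) ^ 2 =
      frobNorm (M - U * (Uᵀ * M)) ^ 2 + frobNorm (U * (Uᵀ * M - X)) ^ 2 := by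
    refine frobNorm_add_sq_of_trace_eq_zero ?_
    rw [← Matrix.mul_assoc, ← transpose_transpose ((M - U * (Uᵀ * M))ᵀ * U), transpose_mul,
      transpose_transpose, h2]
    simp
  have h4 : (M - U * (Uᵀ * M)) + (U * (Uᵀ * M - X)) = M - K := by
    rw [hK, Matrix.mul_sub]; abel
  rw [h4] at h3
  have h5 := pow_le_pow_left₀ (frobNorm_nonneg _) h1 2
  have h6 : U * (Uᵀ * M - X) = 0 := frobNorm_eq_zero (by nlinarith [frobNorm_nonneg (U * (Uᵀ * M - X))])
  rw [← h4, h6, add_zero, h2]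

theorem IsBestRankApprox.transpose {M K : Matrix m k ℝ} (h : IsBestRankApprox n M K) :
    IsBestRankApprox n Mᵀ Kᵀ := by
  refine ⟨by rw [Matrix.rank_transpose]; exact h.1, fun N hN => ?_⟩
  rw [← transpose_sub, frobNorm_transpose, ← frobNorm_transpose (Mᵀ - N), transpose_sub,
    transpose_transpose]
  exact h.2 _ (by rwa [Matrix.rank_transpose])

theorem IsThinSVD.transpose {M : Matrix m k ℝ} {U : Matrix m (Fin n) ℝ}
    {s : Fin n → ℝ} {V : Matrix k (Fin n) ℝ} (h : IsThinSVD M U s V) : IsThinSVD Mᵀ V s U where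
  orth_left := h.orth_right
  orth_right := h.orth_left
  nonneg := h.nonneg
  eq_mul := by rw [h.eq_mul]; simp [Matrix.mul_assoc]

end BestApprox

/-! ### Perturbation of low-rank truncation. -/

section LowRank

variable {m k : Type*} [Fintype m] [Fintype k] [DecidableEq m] [DecidableEq k] {n : ℕ}

theorem specNorm_diagonal_le {t : Fin n → ℝ} {c : ℝ} (hc : 0 ≤ c) (h : ∀ i, |t i| ≤ c) :
    specNorm (diagonal t) ≤ c := by
  rw [specNorm_diagonal]
  exact (pi_norm_le_iff_of_nonneg hc).mpr h

omit [DecidableEq k] in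
theorem frobNorm_sub_proj_le {U : Matrix m (Fin n) ℝ} (hU : Uᵀ * U = 1) (E : Matrix m k ℝ) :
    frobNorm ((1 - U * Uᵀ) * E) ≤ frobNorm E := by
  refine le_of_sq_le_sq ?_ (frobNorm_nonneg _)
  have h0 : Uᵀ * (1 - U * Uᵀ) = 0 := by
    rw [Matrix.mul_sub, ← Matrix.mul_assoc, hU, Matrix.one_mul, Matrix.mul_one, sub_self]
  have h := frobNorm_add_sq_of_trace_eq_zero (M := U * Uᵀ * E) (N := (1 - U * Uᵀ) * E) (by
    have : (U * Uᵀ * E)ᵀ * ((1 - U * Uᵀ) * E) = Eᵀ * U * (Uᵀ * (1 - U * Uᵀ)) * E := by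
      simp only [transpose_mul, transpose_transpose, Matrix.mul_assoc]
    rw [this, h0]
    simp)
  rw [← Matrix.add_mul, add_sub_cancel, Matrix.one_mul] at h
  rw [h]
  nlinarith [sq_nonneg (frobNorm (U * Uᵀ * E))]

omit [DecidableEq m] [DecidableEq k] in
theorem IsThinSVD.rank_le {M : Matrix m k ℝ} {U : Matrix m (Fin n) ℝ} {s : Fin n → ℝ}
    {V : Matrix k (Fin n) ℝ} (h : IsThinSVD M U s V) : M.rank ≤ n := by
  rw [h.eq_mul, Matrix.mul_assoc]
  exact (Matrix.rank_mul_le_left _ _).trans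
    ((Matrix.rank_le_card_width U).trans_eq (Fintype.card_fin n))

/-- A matrix of rank `n` is determined up to second order by its first `n` singular directions:
the component of `L` normal to the singular subspaces of a nearby `K` is quadratically small. -/
theorem frobNorm_normal_component_le {L K : Matrix m k ℝ} {U U' : Matrix m (Fin n) ℝ}
    {s s' : Fin n → ℝ} {V V' : Matrix k (Fin n) ℝ} (hL : IsThinSVD L U s V)
    (hK : IsThinSVD K U' s' V') {σ : ℝ} (hσ : 0 < σ) (hs : ∀ i, σ ≤ s i) :
    frobNorm ((1 - U' * U'ᵀ) * L * (1 - V' * V'ᵀ)) ≤ frobNorm (K - L) ^ 2 / σ := by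
  -- `J` is the pseudoinverse of `L`. Writing `L = L J L` lets each outer projection act on its own
  -- copy of `L`; since both projections kill `K`, each copy becomes `K - L` up to sign, whence the
  -- quadratic bound.
  set J := V * diagonal (fun i => (s i)⁻¹) * Uᵀ with hJ
  have hLJ : L * J * L = L := by
    have h1 : diagonal s * (diagonal (fun i => (s i)⁻¹) * diagonal s) = diagonal s := by
      rw [diagonal_mul_diagonal, diagonal_mul_diagonal]
      congr 1
      ext i
      have : s i ≠ 0 := (hσ.trans_le (hs i)).ne'
      field_simp
    calc L * J * L = U * (diagonal s * ((Vᵀ * V) * (diagonal (fun i => (s i)⁻¹) *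
          ((Uᵀ * U) * diagonal s)))) * Vᵀ := by
          rw [hL.eq_mul, hJ]; simp only [Matrix.mul_assoc]
      _ = L := by rw [hL.orth_left, hL.orth_right, Matrix.one_mul, Matrix.one_mul, h1, ← hL.eq_mul]
  have hleft : (1 - U' * U'ᵀ) * K = 0 := by
    rw [hK.eq_mul, Matrix.mul_assoc U', Matrix.sub_mul, Matrix.one_mul, Matrix.mul_assoc U' U'ᵀ,
      ← Matrix.mul_assoc U'ᵀ, hK.orth_left, Matrix.one_mul, sub_self]
  have hright : K * (1 - V' * V'ᵀ) = 0 := by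
    rw [hK.eq_mul, Matrix.mul_sub, Matrix.mul_one, ← Matrix.mul_assoc,
      Matrix.mul_assoc (U' * diagonal s') V'ᵀ, hK.orth_right, Matrix.mul_one, sub_self]
  have hZ : (1 - U' * U'ᵀ) * L * (1 - V' * V'ᵀ) =
      ((1 - U' * U'ᵀ) * (K - L)) * (J * ((K - L) * (1 - V' * V'ᵀ))) := by
    rw [Matrix.mul_sub _ K, hleft, Matrix.sub_mul K, hright, zero_sub, zero_sub,
      Matrix.mul_neg, Matrix.mul_neg, Matrix.neg_mul, neg_neg]
    conv_lhs => rw [← hLJ]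
    simp only [Matrix.mul_assoc]
  have hJn : specNorm J ≤ 1 / σ := by
    have h1 : specNorm (diagonal fun i => (s i)⁻¹) ≤ 1 / σ := by
      refine specNorm_diagonal_le (by positivity) fun i => ?_
      rw [abs_of_pos (inv_pos.mpr (hσ.trans_le (hs i))), ← one_div]
      exact one_div_le_one_div_of_le hσ (hs i)
    have h2 := specNorm_le_one_of_transpose_mul_self hL.orth_left
    have h3 := specNorm_le_one_of_transpose_mul_self hL.orth_right
    calc specNorm J ≤ specNorm V * specNorm (diagonal fun i => (s i)⁻¹) * specNorm Uᵀ :=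
          (specNorm_mul_le _ _).trans
            (mul_le_mul_of_nonneg_right (specNorm_mul_le _ _) (specNorm_nonneg _))
      _ ≤ 1 * (1 / σ) * 1 := by
          rw [specNorm_transpose]
          have := specNorm_nonneg U
          have := specNorm_nonneg (diagonal fun i => (s i)⁻¹)
          gcongr
      _ = 1 / σ := by ring
  have h4 : frobNorm ((K - L) * (1 - V' * V'ᵀ)) ≤ frobNorm (K - L) := by
    have h5 := frobNorm_sub_proj_le hK.orth_right (K - L)ᵀ
    rw [← frobNorm_transpose, frobNorm_transpose (K - L)] at h5
    simpa only [transpose_mul, transpose_sub (1 : Matrix k k ℝ), transpose_one,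
      transpose_transpose] using h5
  rw [hZ]
  calc _ ≤ frobNorm (K - L) * (1 / σ * frobNorm (K - L)) := by
        refine (frobNorm_mul_le _ _).trans (mul_le_mul (frobNorm_sub_proj_le hK.orth_left _) ?_
          (frobNorm_nonneg _) (frobNorm_nonneg _))
        exact (frobNorm_mul_le_specNorm_mul _ _).trans
          (mul_le_mul hJn h4 (frobNorm_nonneg _) (by positivity))
    _ = _ := by ring

/-- The residual `R = M - K` is orthogonal to `K` and sees only the normal component `Z` of `L`.
Thus `‖M - L‖² = ‖K - L‖² + ‖R‖² - 2 ⟨Z, R⟩ ≥ ‖K - L‖² - ‖Z‖²`, and `Z` is quadratically small. -/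
theorem IsBestRankApprox.frobNorm_sub_sq_le {M L K : Matrix m k ℝ} {U U' : Matrix m (Fin n) ℝ}
    {s s' : Fin n → ℝ} {V V' : Matrix k (Fin n) ℝ} (h : IsBestRankApprox n M K)
    (hL : IsThinSVD L U s V)
    (hK : IsThinSVD K U' s' V') {σ : ℝ} (hσ : 0 < σ) (hs : ∀ i, σ ≤ s i) :
    frobNorm (K - L) ^ 2 ≤ frobNorm (M - L) ^ 2 + (frobNorm (K - L) ^ 2 / σ) ^ 2 := by
  have hUR : U'ᵀ * (M - K) = 0 :=
    h.transpose_mul_sub hK.orth_left (hK.eq_mul.trans (Matrix.mul_assoc _ _ _))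
  have hRV : (M - K) * V' = 0 := by
    have := h.transpose.transpose_mul_sub hK.orth_right
      (hK.transpose.eq_mul.trans (Matrix.mul_assoc _ _ _))
    rw [← transpose_sub, ← transpose_mul] at this
    rw [← transpose_transpose ((M - K) * V'), this, transpose_zero]
  set R := M - K with hR
  set Z := (1 - U' * U'ᵀ) * L * (1 - V' * V'ᵀ) with hZ
  have hKR : Kᵀ * R = 0 := by
    rw [hK.eq_mul, transpose_mul, transpose_mul, Matrix.mul_assoc, Matrix.mul_assoc, hUR]
    simp
  have hZR : (Zᵀ * R).trace = (Lᵀ * R).trace := by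
    have h1 : (1 - U' * U'ᵀ) * R = R := by
      rw [Matrix.sub_mul, Matrix.one_mul, Matrix.mul_assoc, hUR, Matrix.mul_zero, sub_zero]
    have h2 : R * (1 - V' * V'ᵀ) = R := by
      rw [Matrix.mul_sub, Matrix.mul_one, ← Matrix.mul_assoc, hRV, Matrix.zero_mul, sub_zero]
    have h3 : Zᵀ * R = (1 - V' * V'ᵀ) * (Lᵀ * ((1 - U' * U'ᵀ) * R)) := by
      simp only [hZ, transpose_mul, transpose_sub, transpose_one, transpose_transpose,
        Matrix.mul_assoc]
    rw [h3, h1, Matrix.trace_mul_comm, Matrix.mul_assoc, h2]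
  have hD : M - L = (K - L) + R := by rw [hR]; abel
  have h1 := two_mul_trace_le Z R
  have h2 := frobNorm_normal_component_le hL hK hσ hs
  have h3 : frobNorm (M - L) ^ 2
      = frobNorm (K - L) ^ 2 + frobNorm R ^ 2 - 2 * (Lᵀ * R).trace := by
    have h5 : ((K - L)ᵀ * R).trace = -(Lᵀ * R).trace := by
      rw [transpose_sub, Matrix.sub_mul, hKR, zero_sub, trace_neg]
    have h6 : (Rᵀ * (K - L)).trace = -(Lᵀ * R).trace := by
      rw [← h5, ← Matrix.trace_transpose, transpose_mul, transpose_transpose]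
    rw [hD, frobNorm_sq, frobNorm_sq, frobNorm_sq, transpose_add]
    simp only [Matrix.add_mul, Matrix.mul_add, trace_add, h5, h6]
    ring
  have h4 := pow_le_pow_left₀ (frobNorm_nonneg _) h2 2
  rw [hZR] at h1
  linarith

theorem IsBestRankApprox.three_mul_frobNorm_sub_sq_le {M L K : Matrix m k ℝ}
    {U U' : Matrix m (Fin n) ℝ} {s s' : Fin n → ℝ} {V V' : Matrix k (Fin n) ℝ}
    (h : IsBestRankApprox n M K) (hL : IsThinSVD L U s V) (hK : IsThinSVD K U' s' V')
    {σ : ℝ} (hσ : 0 < σ) (hs : ∀ i, σ ≤ s i) (hd : frobNorm (M - L) ≤ σ / 4) :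
    3 * frobNorm (K - L) ^ 2 ≤ 4 * frobNorm (M - L) ^ 2 := by
  have h1 := h.frobNorm_sub_sq_le hL hK hσ hs
  -- Optimality of `K` against `L` gives the crude bound `‖K - L‖ ≤ 2 ‖M - L‖`, which makes the
  -- quartic term at most a quarter of `‖K - L‖²`.
  have h2 : frobNorm (K - L) ≤ σ / 2 := by
    have h3 := h.2 L hL.rank_le
    have h4 := frobNorm_sub_le (M - L) (M - K)
    rw [sub_sub_sub_cancel_left] at h4
    linarith
  set e := frobNorm (K - L)
  have he : 0 ≤ e := frobNorm_nonneg _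
  have h5 : e ^ 2 / σ ≤ e / 2 := by
    rw [div_le_iff₀ hσ]
    nlinarith
  have h6 := pow_le_pow_left₀ (by positivity) h5 2
  nlinarith

end LowRank

/-! ### Orthogonal alignment of balanced factorizations. -/

section Procrustes

variable {m k : Type*} [Fintype m] [Fintype k] {n : ℕ}

/-- Orthogonal Procrustes bounds for balanced factorizations. -/
theorem exists_orthogonal_procrustes {O O' : Matrix m (Fin n) ℝ} {Q Q' : Matrix (Fin n) k ℝ}
    {s s' : Fin n → ℝ} (hO : Oᵀ * O = diagonal s) (hQ : Q * Qᵀ = diagonal s)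
    (hO' : O'ᵀ * O' = diagonal s') (hQ' : Q' * Q'ᵀ = diagonal s') {σ : ℝ} (hs : ∀ i, σ ≤ s i) :
    ∃ T ∈ Matrix.orthogonalGroup (Fin n) ℝ, ∃ x : ℝ,
      frobNorm (O - O' * T) ^ 2 + frobNorm (Q - Tᵀ * Q') ^ 2 = x ∧
      2 * σ * x ≤ 5 * frobNorm (O' * Q' - O * Q) ^ 2 ∧
      4 * σ * x - x ^ 2 ≤ 4 * frobNorm (O' * Q' - O * Q) ^ 2 := by
  -- One `T` must serve both factors, so the polar decomposition is taken of the sum of the two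
  -- cross Gram matrices.
  obtain ⟨T, hT, hS⟩ := exists_orthogonal_mul_posSemidef (Oᵀ * O' + Q * Q'ᵀ)
  have hTT : T * Tᵀ = 1 := (Matrix.mem_orthogonalGroup_iff (Fin n) ℝ).mp hT
  refine ⟨T, hT, _, rfl, ?_⟩
  obtain ⟨P, hP⟩ : ∃ P, O' * T = P := ⟨_, rfl⟩
  obtain ⟨W, hW⟩ : ∃ W, Tᵀ * Q' = W := ⟨_, rfl⟩
  have hPW : O' * Q' = P * W := by
    rw [← hP, ← hW, Matrix.mul_assoc, ← Matrix.mul_assoc T, hTT, Matrix.one_mul]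
  obtain ⟨b, hb⟩ : ∃ b, Tᵀ * diagonal s' * T = b := ⟨_, rfl⟩
  have hPP : Pᵀ * P = b := by
    rw [← hP, ← hb, ← hO']; simp only [transpose_mul, Matrix.mul_assoc]
  have hWW : W * Wᵀ = b := by
    rw [← hW, ← hb, ← hQ']; simp only [transpose_mul, transpose_transpose, Matrix.mul_assoc]
  obtain ⟨u, hu⟩ : ∃ u, Oᵀ * P = u := ⟨_, rfl⟩
  obtain ⟨v, hv⟩ : ∃ v, Q * Wᵀ = v := ⟨_, rfl⟩
  have hS' : (u + v).PosSemidef := by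
    rw [← hu, ← hv, ← hP, ← hW, transpose_mul, transpose_transpose, ← Matrix.mul_assoc,
      ← Matrix.mul_assoc, ← Matrix.add_mul]
    exact hS
  have hST : uᵀ + vᵀ = u + v := by simpa using hS'.isHermitian.eq
  rw [hP, hW, hPW]
  set G := (O - P)ᵀ * (O - P) + (Q - W) * (Q - W)ᵀ with hG
  have huT : Pᵀ * O = uᵀ := by rw [← hu, transpose_mul, transpose_transpose]
  have hvT : W * Qᵀ = vᵀ := by rw [← hv, transpose_mul, transpose_transpose]
  -- Balancedness makes the Gram matrices of both factors equal, and symmetry of `u + v` merges the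
  -- cross terms. Thus `G` has the form required by `procrustes_trace_bounds`, with `α = 2 Σ` and `β
  -- = 2 b`.
  have hGeq : (2:ℝ) • diagonal s + (2:ℝ) • b - (2:ℝ) • (u + v) = G := by
    rw [hG]
    simp only [transpose_sub, Matrix.sub_mul, Matrix.mul_sub, hO, hQ, hPP, hWW, hu, hv, huT, hvT]
    have : (2:ℝ) • (u + v) = (u + v) + (uᵀ + vᵀ) := by rw [hST, two_smul]
    rw [this, two_smul, two_smul]
    abel
  have hGpos : G.PosSemidef := by
    rw [hG]
    have h1 := posSemidef_conjTranspose_mul_self (O - P)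
    have h2 := posSemidef_self_mul_conjTranspose (Q - W)
    rw [conjTranspose_eq_transpose_of_trivial] at h1 h2
    exact h1.add h2
  have hx : G.trace = frobNorm (O - P) ^ 2 + frobNorm (Q - W) ^ 2 := by
    rw [hG, trace_add, frobNorm_sq, frobNorm_sq']
  have hGx : (G * G).trace ≤ (frobNorm (O - P) ^ 2 + frobNorm (Q - W) ^ 2) ^ 2 := by
    have h1 : Gᵀ = G := by simpa using hGpos.isHermitian.eq
    have h2 := frobNorm_sq G
    rw [h1] at h2
    rw [← h2]
    refine pow_le_pow_left₀ (frobNorm_nonneg _) ?_ 2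
    refine (frobNorm_add_le _ _).trans (add_le_add ?_ ?_)
    · refine (frobNorm_mul_le _ _).trans_eq ?_
      rw [frobNorm_transpose, sq]
    · refine (frobNorm_mul_le _ _).trans_eq ?_
      rw [frobNorm_transpose, sq]
  have hN : (((2:ℝ) • diagonal s) * ((2:ℝ) • diagonal s)).trace + (((2:ℝ) • b) * ((2:ℝ) • b)).trace
      - 2 * ((u + v) * (u + v)).trace ≤ 4 * frobNorm (P * W - O * Q) ^ 2 := by
    -- The product error involves only `tr (u vᵀ)`; this inequality gives `tr (u + v)² ≥ 4 tr (u
    -- vᵀ)`.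
    have h1 := two_mul_trace_le uᵀ vᵀ
    have h2 : frobNorm (P * W - O * Q) ^ 2 =
        (diagonal s * diagonal s).trace + (b * b).trace - 2 * (u * vᵀ).trace := by
      have e1 : ((P * W)ᵀ * (P * W)).trace = (b * b).trace := by
        rw [transpose_mul, Matrix.mul_assoc, Matrix.trace_mul_comm, ← Matrix.mul_assoc, hPP,
          Matrix.mul_assoc, hWW]
      have e2 : ((O * Q)ᵀ * (O * Q)).trace = (diagonal s * diagonal s).trace := by
        rw [transpose_mul, Matrix.mul_assoc, Matrix.trace_mul_comm, ← Matrix.mul_assoc, hO,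
          Matrix.mul_assoc, hQ]
      have e3 : ((O * Q)ᵀ * (P * W)).trace = (u * vᵀ).trace := by
        rw [transpose_mul, Matrix.mul_assoc, Matrix.trace_mul_comm, ← Matrix.mul_assoc, hu,
          Matrix.mul_assoc, hvT]
      have e4 : ((P * W)ᵀ * (O * Q)).trace = (u * vᵀ).trace := by
        rw [← e3, ← Matrix.trace_transpose, transpose_mul, transpose_transpose]
      rw [frobNorm_sq, transpose_sub]
      simp only [Matrix.sub_mul, Matrix.mul_sub, trace_sub, e1, e2, e3, e4]
      ring
    have h3 : ((u + v) * (u + v)).trace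
        = frobNorm uᵀ ^ 2 + frobNorm vᵀ ^ 2 + 2 * (u * vᵀ).trace := by
      have e5 : (v * uᵀ).trace = (u * vᵀ).trace := by
        rw [← Matrix.trace_transpose, transpose_mul, transpose_transpose]
      have e6 : (u + v) * (u + v) = (u + v) * (uᵀ + vᵀ) := by rw [hST]
      rw [e6, frobNorm_transpose, frobNorm_transpose, frobNorm_sq', frobNorm_sq']
      simp only [Matrix.add_mul, Matrix.mul_add, trace_add, e5]
      ring
    rw [transpose_transpose] at h1
    rw [h2, h3]
    simp only [Matrix.smul_mul, Matrix.mul_smul, trace_smul, smul_eq_mul]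
    linarith
  have hαG : 2 * σ * G.trace ≤ (G * ((2:ℝ) • diagonal s)).trace := by
    simp only [Matrix.trace, Matrix.diag, Matrix.mul_smul, Matrix.smul_apply, Matrix.mul_diagonal,
      smul_eq_mul, Finset.mul_sum]
    refine Finset.sum_le_sum fun i _ => ?_
    have := mul_le_mul_of_nonneg_left (hs i) (hGpos.diag_nonneg (i := i))
    linarith
  have key := procrustes_trace_bounds (α := (2:ℝ) • diagonal s) (β := (2:ℝ) • b) (S := u + v)
    (τ := 2 * σ) (x := frobNorm (O - P) ^ 2 + frobNorm (Q - W) ^ 2)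
    (N := 4 * frobNorm (P * W - O * Q) ^ 2)
    (by simp [Matrix.IsHermitian, diagonal_transpose]) (by rw [hGeq]; exact hαG) hS'
    (by rw [hGeq]; exact hGpos) (by rw [hGeq]; exact hx) (by rw [hGeq]; exact hGx) hN
  constructor
  · linarith [key.1]
  · linarith [key.2]

end Procrustes

/-! ### Pseudoinverses and perturbation of the state matrix. -/

section Pseudoinverse

variable {m k : Type*} [Fintype m] [Fintype k] {n : ℕ}

theorem IsPseudoinverse.transpose {M : Matrix m k ℝ} {X : Matrix k m ℝ}
    (h : IsPseudoinverse M X) : IsPseudoinverse Mᵀ Xᵀ where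
  mul_mul_self := by rw [← transpose_mul, ← transpose_mul, ← Matrix.mul_assoc, h.mul_mul_self]
  mul_mul_inv := by rw [← transpose_mul, ← transpose_mul, ← Matrix.mul_assoc, h.mul_mul_inv]
  symm_left := by rw [← transpose_mul, transpose_transpose, h.symm_right]
  symm_right := by rw [← transpose_mul, transpose_transpose, h.symm_left]

/-- The Penrose conditions give the normal equations `Mᵀ M X = Mᵀ`, which here read `D² X = D Uᵀ`
with `D` invertible. -/
theorem IsPseudoinverse.eq_diagonal_mul {U : Matrix m (Fin n) ℝ} {t : Fin n → ℝ}
    {X : Matrix (Fin n) m ℝ} (h : IsPseudoinverse (U * diagonal t) X) (hU : Uᵀ * U = 1)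
    (ht : ∀ i, 0 < t i) : X = diagonal (fun i => (t i)⁻¹) * Uᵀ := by
  have hinv : diagonal (fun i => (t i)⁻¹) * diagonal t = 1 := by
    rw [diagonal_mul_diagonal, ← diagonal_one]
    congr 1
    ext i
    exact inv_mul_cancel₀ (ht i).ne'
  set D := diagonal t with hD
  set E := diagonal fun i => (t i)⁻¹ with hE
  have hDT : Dᵀ = D := diagonal_transpose t
  have h1 : (U * D)ᵀ * (U * D * X) = (U * D)ᵀ := by
    rw [← h.symm_left, ← transpose_mul, h.mul_mul_self]
  have h2 : (U * D)ᵀ * (U * D * X) = D * (D * X) := by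
    rw [transpose_mul, hDT]
    calc D * Uᵀ * (U * D * X) = D * ((Uᵀ * U) * (D * X)) := by simp only [Matrix.mul_assoc]
      _ = _ := by rw [hU, Matrix.one_mul]
  rw [h2, transpose_mul, hDT] at h1
  calc X = (E * D) * ((E * D) * X) := by rw [hinv, Matrix.one_mul, Matrix.one_mul]
    _ = E * ((E * D) * (D * X)) := by
        rw [hinv, Matrix.one_mul, Matrix.one_mul, Matrix.one_mul, ← Matrix.mul_assoc, hinv,
          Matrix.one_mul]
    _ = E * (E * (D * (D * X))) := by simp only [Matrix.mul_assoc]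
    _ = E * ((E * D) * Uᵀ) := by rw [h1, Matrix.mul_assoc]
    _ = _ := by rw [hinv, Matrix.one_mul]

theorem specNorm_diagonal_inv_sqrt_mul_transpose_le [DecidableEq m] {U : Matrix m (Fin n) ℝ}
    {s : Fin n → ℝ} (hU : Uᵀ * U = 1) {τ : ℝ} (hτ : 0 < τ) (hs : ∀ i, τ ≤ s i) :
    specNorm (diagonal (fun i => (√(s i))⁻¹) * Uᵀ) ≤ (√τ)⁻¹ := by
  have h1 : specNorm (diagonal fun i => (√(s i))⁻¹) ≤ (√τ)⁻¹ := by
    refine specNorm_diagonal_le (by positivity) fun i => ?_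
    rw [abs_of_nonneg (by positivity)]
    exact inv_anti₀ (Real.sqrt_pos.mpr hτ) (Real.sqrt_le_sqrt (hs i))
  have h2 := specNorm_le_one_of_transpose_mul_self hU
  rw [← specNorm_transpose] at h2
  refine (specNorm_mul_le _ _).trans ?_
  calc _ ≤ (√τ)⁻¹ * 1 := mul_le_mul h1 h2 (specNorm_nonneg _) (by positivity)
    _ = _ := mul_one _

theorem diagonal_sqrt_mul_self {s : Fin n → ℝ} (hs : ∀ i, 0 ≤ s i) :
    diagonal (fun i => √(s i)) * diagonal (fun i => √(s i)) = diagonal s := by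
  rw [diagonal_mul_diagonal]
  congr 1
  ext i
  exact Real.mul_self_sqrt (hs i)

theorem diagonal_sqrt_mul_inv {s : Fin n → ℝ} (hs : ∀ i, 0 < s i) :
    diagonal (fun i => √(s i)) * diagonal (fun i => (√(s i))⁻¹) = 1 := by
  rw [diagonal_mul_diagonal, ← diagonal_one]
  congr 1
  ext i
  exact mul_inv_cancel₀ (Real.sqrt_pos.mpr (hs i)).ne'

theorem diagonal_inv_mul_sqrt {s : Fin n → ℝ} (hs : ∀ i, 0 < s i) :
    diagonal (fun i => (√(s i))⁻¹) * diagonal (fun i => √(s i)) = 1 := by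
  rw [diagonal_mul_diagonal, ← diagonal_one]
  congr 1
  ext i
  exact inv_mul_cancel₀ (Real.sqrt_pos.mpr (hs i)).ne'

/-- A rank factorization of `M` has the same column and row space as its decomposition. -/
theorem IsThinSVD.proj_of_eq_mul {M : Matrix m k ℝ} {U : Matrix m (Fin n) ℝ} {s : Fin n → ℝ}
    {V : Matrix k (Fin n) ℝ} (h : IsThinSVD M U s V) (hs : ∀ i, 0 < s i)
    {F : Matrix m (Fin n) ℝ} {G : Matrix (Fin n) k ℝ} (hM : M = F * G) :
    U * Uᵀ * F = F ∧ G * (V * Vᵀ) = G := by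
  have h1 : diagonal s * diagonal (fun i => (s i)⁻¹) = 1 := by
    rw [diagonal_mul_diagonal, ← diagonal_one]
    congr 1
    ext i
    exact mul_inv_cancel₀ (hs i).ne'
  have h1' : diagonal (fun i => (s i)⁻¹) * diagonal s = 1 := mul_eq_one_comm.mp h1
  set S := diagonal s
  set R := diagonal fun i => (s i)⁻¹
  have hMV : M * V = U * S := by
    rw [h.eq_mul, Matrix.mul_assoc, h.orth_right, Matrix.mul_one]
  have hUM : Uᵀ * M = S * Vᵀ := by
    rw [h.eq_mul, ← Matrix.mul_assoc, ← Matrix.mul_assoc, h.orth_left, Matrix.one_mul]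
  -- The factors are square of order `n`, so these one-sided inverses are two-sided and can be
  -- cancelled in the other order below.
  have h2 : (Uᵀ * F) * (G * V * R) = 1 := by
    calc (Uᵀ * F) * (G * V * R) = (Uᵀ * (F * G)) * V * R := by simp only [Matrix.mul_assoc]
      _ = 1 := by
        rw [← hM, hUM, Matrix.mul_assoc S, h.orth_right, Matrix.mul_one, h1]
  have h3 : (R * (Uᵀ * F)) * (G * V) = 1 := by
    calc (R * (Uᵀ * F)) * (G * V) = R * ((Uᵀ * (F * G)) * V) := by simp only [Matrix.mul_assoc]
      _ = 1 := by
        rw [← hM, hUM, Matrix.mul_assoc S, h.orth_right, Matrix.mul_one, h1']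
  constructor
  · calc U * Uᵀ * F = (U * (S * R)) * (Uᵀ * F) := by rw [h1, Matrix.mul_one, Matrix.mul_assoc]
      _ = (M * V) * R * (Uᵀ * F) := by rw [hMV]; simp only [Matrix.mul_assoc]
      _ = F * ((G * V * R) * (Uᵀ * F)) := by rw [hM]; simp only [Matrix.mul_assoc]
      _ = F := by rw [mul_eq_one_comm.mp h2, Matrix.mul_one]
  · calc G * (V * Vᵀ) = G * V * ((R * S) * Vᵀ) := by
          rw [h1', Matrix.one_mul, Matrix.mul_assoc]
      _ = G * V * (R * (Uᵀ * M)) := by rw [hUM, Matrix.mul_assoc R]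
      _ = ((G * V) * (R * (Uᵀ * F))) * G := by rw [hM]; simp only [Matrix.mul_assoc]
      _ = G := by rw [mul_eq_one_comm.mp h3, Matrix.one_mul]

theorem IsThinSVD.le_specNorm [DecidableEq m] [DecidableEq k] {M : Matrix m k ℝ}
    {U : Matrix m (Fin n) ℝ} {s : Fin n → ℝ}
    {V : Matrix k (Fin n) ℝ} (h : IsThinSVD M U s V) (i : Fin n) : s i ≤ specNorm M := by
  have h1 : Uᵀ * M * V = diagonal s := by
    rw [h.eq_mul, ← Matrix.mul_assoc, ← Matrix.mul_assoc, h.orth_left, Matrix.one_mul,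
      Matrix.mul_assoc, h.orth_right, Matrix.mul_one]
  have h2 := norm_le_pi_norm s i
  rw [← specNorm_diagonal, ← h1, Real.norm_eq_abs] at h2
  have hU := specNorm_le_one_of_transpose_mul_self h.orth_left
  rw [← specNorm_transpose] at hU
  calc s i ≤ specNorm (Uᵀ * M * V) := (le_abs_self _).trans h2
    _ ≤ specNorm (Uᵀ * M) * specNorm V := specNorm_mul_le _ _
    _ ≤ specNorm (Uᵀ * M) :=
        mul_le_of_le_one_right (specNorm_nonneg _) (specNorm_le_one_of_transpose_mul_self h.orth_right)
    _ ≤ specNorm Uᵀ * specNorm M := specNorm_mul_le _ _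
    _ ≤ specNorm M := mul_le_of_le_one_left (specNorm_nonneg _) hU

/-- Perturbation of the solution `Ā` of `O * Ā * Q = H`. -/
theorem frobNorm_sub_pinv_mul_le [DecidableEq m] [DecidableEq k] {O P : Matrix m (Fin n) ℝ}
    {Q W : Matrix (Fin n) k ℝ} {X : Matrix (Fin n) m ℝ} {Y : Matrix k (Fin n) ℝ}
    {A : Matrix (Fin n) (Fin n) ℝ} {H H' : Matrix m k ℝ} (hH : H = O * A * Q)
    (hX : X * P = 1) (hY : W * Y = 1) {r μ : ℝ} (hXr : specNorm X ≤ r) (hYr : specNorm Y ≤ r)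
    (hA : specNorm A ≤ μ) :
    frobNorm (A - X * H' * Y) ≤ μ * (r * frobNorm (O - P) + r * frobNorm (Q - W)
      + r ^ 2 * (frobNorm (O - P) * frobNorm (Q - W))) + r ^ 2 * frobNorm (H' - H) := by
  have hr : 0 ≤ r := (specNorm_nonneg _).trans hXr
  have hμ : 0 ≤ μ := (specNorm_nonneg _).trans hA
  obtain ⟨D, hD⟩ : ∃ D, H' - H = D := ⟨_, rfl⟩
  obtain ⟨a, ha⟩ : ∃ a, X * (P - O) = a := ⟨_, rfl⟩
  obtain ⟨b, hb⟩ : ∃ b, (W - Q) * Y = b := ⟨_, rfl⟩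
  have ha' : X * O = 1 - a := by rw [← ha, Matrix.mul_sub, hX, sub_sub_cancel]
  have hb' : Q * Y = 1 - b := by rw [← hb, Matrix.sub_mul, hY, sub_sub_cancel]
  -- Since `X O = 1 - a` and `Q Y = 1 - b`, the product `X H Y` is `(1 - a) A (1 - b)`.
  have key : A - X * H' * Y = a * A + A * b - a * A * b - X * D * Y := by
    have h1 : X * H' * Y = (X * O) * A * (Q * Y) + X * D * Y := by
      rw [show H' = H + D by rw [← hD]; abel, hH, Matrix.mul_add, Matrix.add_mul]
      simp only [Matrix.mul_assoc]
    rw [h1, ha', hb', Matrix.sub_mul, Matrix.one_mul, Matrix.sub_mul, Matrix.mul_sub,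
      Matrix.mul_sub, Matrix.mul_one, Matrix.mul_one]
    abel
  have hna : frobNorm a ≤ r * frobNorm (O - P) := by
    rw [← ha, frobNorm_sub_rev O P]
    exact (frobNorm_mul_le_specNorm_mul _ _).trans
      (mul_le_mul_of_nonneg_right hXr (frobNorm_nonneg _))
  have hnb : frobNorm b ≤ r * frobNorm (Q - W) := by
    rw [← hb, frobNorm_sub_rev Q W, mul_comm r]
    exact (frobNorm_mul_le_mul_specNorm _ _).trans
      (mul_le_mul_of_nonneg_left hYr (frobNorm_nonneg _))
  have hnaA : frobNorm (a * A) ≤ r * frobNorm (O - P) * μ :=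
    (frobNorm_mul_le_mul_specNorm _ _).trans
      (mul_le_mul hna hA (specNorm_nonneg _) (mul_nonneg hr (frobNorm_nonneg _)))
  have hnAb : frobNorm (A * b) ≤ μ * (r * frobNorm (Q - W)) :=
    (frobNorm_mul_le_specNorm_mul _ _).trans (mul_le_mul hA hnb (frobNorm_nonneg _) hμ)
  have hnaAb : frobNorm (a * A * b) ≤ r * frobNorm (O - P) * μ * (r * frobNorm (Q - W)) :=
    (frobNorm_mul_le _ _).trans (mul_le_mul hnaA hnb (frobNorm_nonneg _)
      (mul_nonneg (mul_nonneg hr (frobNorm_nonneg _)) hμ))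
  have hnD : frobNorm (X * D * Y) ≤ r * frobNorm D * r :=
    (frobNorm_mul_le_mul_specNorm _ _).trans (mul_le_mul
      ((frobNorm_mul_le_specNorm_mul _ _).trans
        (mul_le_mul_of_nonneg_right hXr (frobNorm_nonneg _))) hYr (specNorm_nonneg _)
      (mul_nonneg hr (frobNorm_nonneg _)))
  rw [key, hD]
  have t1 := frobNorm_sub_le (a * A + A * b - a * A * b) (X * D * Y)
  have t2 := frobNorm_sub_le (a * A + A * b) (a * A * b)
  have t3 := frobNorm_add_le (a * A) (A * b)
  nlinarith

end Pseudoinverse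

/-! ### Block Hankel matrices. -/

section Hankel

variable {n p : ℕ}

/-- Within one block row the blocks are distinct blocks of `G`, and there are `L / 2` block rows. -/
theorem frobNorm_hankelOf_sq_le {L : ℕ} (G : Matrix (Fin p) (Fin L × Fin p) ℝ) :
    frobNorm (hankelOf G) ^ 2 ≤ (L / 2 : ℕ) * frobNorm G ^ 2 := by
  rw [frobNorm_sq_eq_sum, frobNorm_sq_eq_sum, Fintype.sum_prod_type]
  have h : ∀ i : Fin (L / 2), ∑ a : Fin p, ∑ c, hankelOf G (i, a) c ^ 2 ≤ ∑ a, ∑ c, G a c ^ 2 := by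
    intro i
    refine Finset.sum_le_sum fun a _ => ?_
    refine sum_comp_le_sum_of_injective (f := fun c => G a c ^ 2) (fun _ => by positivity)
      (g := fun c : Fin (L / 2 + 1) × Fin p => (⟨(i : ℕ) + (c.1 : ℕ), by omega⟩, c.2)) ?_
    rintro ⟨c, b⟩ ⟨c', b'⟩ hc
    simp only [Prod.mk.injEq, Fin.mk.injEq] at hc
    ext
    · simp; omega
    · simp [hc.2]
  calc _ ≤ ∑ _i : Fin (L / 2), ∑ a, ∑ c, G a c ^ 2 := Finset.sum_le_sum fun i _ => h i
    _ = _ := by simp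

theorem frobNorm_hankelMinus_sub_le {k : ℕ} (H H' : Matrix (Fin k × Fin p) (Fin (k + 1) × Fin p) ℝ) :
    frobNorm (hankelMinus H - hankelMinus H') ≤ frobNorm (H - H') :=
  frobNorm_submatrix_le (H - H') Function.injective_id
    (g := fun c : Fin k × Fin p => (c.1.castSucc, c.2)) fun c c' h => by
      simpa [Prod.ext_iff] using h

theorem frobNorm_hankelPlus_sub_le {k : ℕ} (H H' : Matrix (Fin k × Fin p) (Fin (k + 1) × Fin p) ℝ) :
    frobNorm (hankelPlus H - hankelPlus H') ≤ frobNorm (H - H') :=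
  frobNorm_submatrix_le (H - H') Function.injective_id
    (g := fun c : Fin k × Fin p => (c.1.succ, c.2)) fun c c' h => by
      simpa [Prod.ext_iff] using h

theorem specNorm_hankelMinus_le {k : ℕ} (H : Matrix (Fin k × Fin p) (Fin (k + 1) × Fin p) ℝ) :
    specNorm (hankelMinus H) ≤ specNorm H :=
  specNorm_submatrix_right_le H
    (g := fun c : Fin k × Fin p => (c.1.castSucc, c.2)) fun c c' h => by
      simpa [Prod.ext_iff] using h

theorem specNorm_hankelPlus_le {k : ℕ} (H : Matrix (Fin k × Fin p) (Fin (k + 1) × Fin p) ℝ) :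
    specNorm (hankelPlus H) ≤ specNorm H :=
  specNorm_submatrix_right_le H
    (g := fun c : Fin k × Fin p => (c.1.succ, c.2)) fun c c' h => by
      simpa [Prod.ext_iff] using h

theorem hankelMinus_clippedHankel (A : Matrix (Fin n) (Fin n) ℝ) (B : Matrix (Fin n) (Fin p) ℝ)
    (C : Matrix (Fin p) (Fin n) ℝ) (L : ℕ) : hankelMinus (clippedHankel A B C L) =
      observabilityMatrix A C (L / 2) * controllabilityMatrix A B (L / 2) := rfl

theorem hankelPlus_clippedHankel (A : Matrix (Fin n) (Fin n) ℝ) (B : Matrix (Fin n) (Fin p) ℝ)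
    (C : Matrix (Fin p) (Fin n) ℝ) (L : ℕ) : hankelPlus (clippedHankel A B C L) =
      observabilityMatrix A C (L / 2) * (A * controllabilityMatrix A B (L / 2)) := by
  have h : (controllabilityMatrix A B (L / 2 + 1)).submatrix id
      (fun c : Fin (L / 2) × Fin p => (c.1.succ, c.2)) = A * controllabilityMatrix A B (L / 2) := by
    ext i c
    have h1 : A ^ ((c.1 : ℕ) + 1) * B = A * (A ^ (c.1 : ℕ) * B) := by
      rw [pow_succ', Matrix.mul_assoc]
    simp only [controllabilityMatrix, submatrix_apply, of_apply, Fin.val_succ, h1]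
    rfl
  rw [← h]
  rfl

end Hankel

/-! ### Numerical bookkeeping. -/

section Scalar

theorem procrustes_scalar_bound {σ x e d : ℝ} (hσ : 0 < σ) (hx : 0 ≤ x)
    (h1 : 2 * σ * x ≤ 5 * e ^ 2) (h2 : 4 * σ * x - x ^ 2 ≤ 4 * e ^ 2)
    (he : 3 * e ^ 2 ≤ 4 * d ^ 2) (hd0 : 0 ≤ d) (hd : d ≤ σ / 4) : σ * x ≤ 141 / 100 * d ^ 2 := by
  have h3 : d ^ 2 ≤ σ ^ 2 / 16 := by nlinarith
  -- The crude bound `h1` controls the `x²` in `h2`; then `(4 - 5/24) σ x ≤ 16/3 d²`, and `128/91 <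
  -- 1.41`.
  have h4 : x ≤ 5 / 24 * σ := by
    refine le_of_mul_le_mul_left ?_ hσ
    nlinarith
  nlinarith

theorem realization_scalar_bound {σ r a b d q h h' y : ℝ} (hσ : 0 < σ)
    (hr2 : r ^ 2 = (71 / 100 * σ)⁻¹)
    (hab : σ * (a ^ 2 + b ^ 2) ≤ 141 / 100 * d ^ 2) (hd0 : 0 ≤ d) (hd : d ≤ σ / 4)
    (hq : 2 * d ^ 2 ≤ q ^ 2) (hq0 : 0 ≤ q) (hh : σ ≤ h) (hh' : h ≤ d + h')
    (hy : y ≤ h / σ * (r * a + r * b + r ^ 2 * (a * b)) + r ^ 2 * d) :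
    y ≤ ((h + h') / σ ^ 2 + 1 / σ) * q := by
  have hh0 : 0 ≤ h := hσ.le.trans hh
  have hq1 : 141 / 100 * d ≤ q := by nlinarith
  -- Here `1.41 / 0.71 < 2`.
  have hx : r ^ 2 * (a ^ 2 + b ^ 2) ≤ 2 * (d / σ) ^ 2 := by
    rw [hr2, div_pow, inv_mul_le_iff₀ (by positivity)]
    have : 71 / 100 * σ * (2 * (d ^ 2 / σ ^ 2)) = 142 / 100 * d ^ 2 / σ := by
      field_simp; ring
    rw [this, le_div_iff₀ hσ]
    nlinarith
  have h1 : r * a + r * b ≤ 2 * (d / σ) := by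
    refine le_of_sq_le_sq ?_ (by positivity)
    nlinarith [sq_nonneg (r * a - r * b)]
  have h2 : r ^ 2 * (a * b) ≤ (d / σ) ^ 2 := by nlinarith [sq_nonneg (a - b), sq_nonneg (r * (a - b))]
  have hδ : d / σ ≤ 1 / 4 := by rw [div_le_iff₀ hσ]; linarith
  have hδ0 : 0 ≤ d / σ := by positivity
  have h3 : r * a + r * b + r ^ 2 * (a * b) ≤ 9 / 4 * (d / σ) := by nlinarith
  have h4 : y ≤ h / σ * (9 / 4 * (d / σ)) + (100 / 71) * (d / σ) := by
    refine hy.trans (add_le_add (mul_le_mul_of_nonneg_left h3 (by positivity)) (le_of_eq ?_))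
    rw [hr2]; field_simp
  -- The target contains `h'`, which is at least `h - d ≥ h - σ / 4`.
  have h5 : (2 * h - σ / 4) / σ ^ 2 + 1 / σ ≤ (h + h') / σ ^ 2 + 1 / σ := by
    gcongr
    linarith
  have h6 : (2 * h - σ / 4) / σ ^ 2 + 1 / σ = (2 * (h / σ) + 3 / 4) / σ := by
    field_simp; ring
  have h7 : 1 ≤ h / σ := by rw [le_div_iff₀ hσ]; linarith
  calc y ≤ h / σ * (9 / 4 * (d / σ)) + (100 / 71) * (d / σ) := h4
    _ ≤ (2 * (h / σ) + 3 / 4) * (141 / 100) * (d / σ) := by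
        -- The slope in `h / σ` is larger on the right, so the worst case is `h / σ = 1`.
        have : h / σ * (9 / 4) + 100 / 71 ≤ (2 * (h / σ) + 3 / 4) * (141 / 100) := by linarith
        nlinarith [mul_le_mul_of_nonneg_right this hδ0]
    _ = (2 * (h / σ) + 3 / 4) / σ * (141 / 100 * d) := by ring
    _ ≤ ((h + h') / σ ^ 2 + 1 / σ) * q := by
        rw [h6] at h5
        exact mul_le_mul h5 hq1 (by positivity) ((by positivity : (0:ℝ) ≤ _).trans h5)

end Scalar

/-! ### Balanced factors of a thin decomposition. -/

section Realization

variable {m k : Type*} [Fintype m] [Fintype k] {n : ℕ}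

theorem IsThinSVD.transpose_mul_sqrt {M : Matrix m k ℝ} {U : Matrix m (Fin n) ℝ}
    {s : Fin n → ℝ} {V : Matrix k (Fin n) ℝ} (h : IsThinSVD M U s V) :
    (U * diagonal fun i => √(s i))ᵀ * (U * diagonal fun i => √(s i)) = diagonal s := by
  rw [transpose_mul, diagonal_transpose, Matrix.mul_assoc, ← Matrix.mul_assoc Uᵀ, h.orth_left,
    Matrix.one_mul, diagonal_sqrt_mul_self h.nonneg]

theorem IsThinSVD.sqrt_mul_transpose {M : Matrix m k ℝ} {U : Matrix m (Fin n) ℝ}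
    {s : Fin n → ℝ} {V : Matrix k (Fin n) ℝ} (h : IsThinSVD M U s V) :
    (diagonal fun i => √(s i)) * Vᵀ * ((diagonal fun i => √(s i)) * Vᵀ)ᵀ = diagonal s := by
  have := h.transpose.transpose_mul_sqrt
  rwa [transpose_mul, diagonal_transpose] at this ⊢

theorem IsThinSVD.sqrt_mul_sqrt {M : Matrix m k ℝ} {U : Matrix m (Fin n) ℝ}
    {s : Fin n → ℝ} {V : Matrix k (Fin n) ℝ} (h : IsThinSVD M U s V) :
    (U * diagonal fun i => √(s i)) * ((diagonal fun i => √(s i)) * Vᵀ) = M := by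
  rw [Matrix.mul_assoc, ← Matrix.mul_assoc (diagonal _), diagonal_sqrt_mul_self h.nonneg,
    ← Matrix.mul_assoc, ← h.eq_mul]

theorem IsPseudoinverse.mul_eq_one {U : Matrix m (Fin n) ℝ} {s : Fin n → ℝ}
    {X : Matrix (Fin n) m ℝ} (h : IsPseudoinverse (U * diagonal fun i => √(s i)) X)
    (hU : Uᵀ * U = 1) (hs : ∀ i, 0 < s i) :
    X * (U * diagonal fun i => √(s i)) = 1 ∧ (U * diagonal fun i => √(s i)) * X = U * Uᵀ := by
  rw [h.eq_diagonal_mul hU fun i => Real.sqrt_pos.mpr (hs i)]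
  constructor
  · rw [Matrix.mul_assoc, ← Matrix.mul_assoc Uᵀ, hU, Matrix.one_mul, diagonal_inv_mul_sqrt hs]
  · rw [Matrix.mul_assoc, ← Matrix.mul_assoc (diagonal _), diagonal_sqrt_mul_inv hs, Matrix.one_mul]

theorem IsPseudoinverse.specNorm_le [DecidableEq m] {U : Matrix m (Fin n) ℝ} {s : Fin n → ℝ}
    {X : Matrix (Fin n) m ℝ} (h : IsPseudoinverse (U * diagonal fun i => √(s i)) X)
    (hU : Uᵀ * U = 1) {τ : ℝ} (hτ : 0 < τ) (hs : ∀ i, τ ≤ s i) : specNorm X ≤ (√τ)⁻¹ := by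
  rw [h.eq_diagonal_mul hU fun i => Real.sqrt_pos.mpr (hτ.trans_le (hs i))]
  exact specNorm_diagonal_inv_sqrt_mul_transpose_le hU hτ hs

theorem IsPseudoinverse.transpose_sqrt_mul {V : Matrix k (Fin n) ℝ} {s : Fin n → ℝ}
    {Y : Matrix k (Fin n) ℝ} (h : IsPseudoinverse ((diagonal fun i => √(s i)) * Vᵀ) Y) :
    IsPseudoinverse (V * diagonal fun i => √(s i)) Yᵀ := by
  have := h.transpose
  rwa [transpose_mul, diagonal_transpose, transpose_transpose] at this

end Realization

end HoKalman

/-! ### The robustness theorem. -/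

open Matrix in
theorem mainTheorem4 (n p L : ℕ) (hn : 1 ≤ n) (hL : 2 ≤ L)
    (A : Matrix (Fin n) (Fin n) ℝ) (B : Matrix (Fin n) (Fin p) ℝ) (C : Matrix (Fin p) (Fin n) ℝ)
    (hctrl : HoKalman.IsControllable A B) (hobs : HoKalman.IsObservable A C)
    (Ghat : Matrix (Fin p) (Fin L × Fin p) ℝ)
    (Lmat : Matrix (Fin (L / 2) × Fin p) (Fin (L / 2) × Fin p) ℝ)
    (hLmat : HoKalman.IsBestRankApprox n
      (HoKalman.hankelMinus (HoKalman.clippedHankel A B C L)) Lmat)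
    (hσ : 0 < HoKalman.nthSingularValue n Lmat)
    (hG : HoKalman.frobNorm (HoKalman.markovMatrix A B C L - Ghat)
      ≤ HoKalman.nthSingularValue n Lmat / (2 * Real.sqrt (2 * (L : ℝ))))
    (Abar Ahat : Matrix (Fin n) (Fin n) ℝ) (Bbar Bhat : Matrix (Fin n) (Fin p) ℝ)
    (Cbar Chat : Matrix (Fin p) (Fin n) ℝ)
    (hbar : HoKalman.IsHoKalmanOutput n (Nat.div_pos hL two_pos)
      (HoKalman.clippedHankel A B C L) Abar Bbar Cbar)
    (hhat : HoKalman.IsHoKalmanOutput n (Nat.div_pos hL two_pos)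
      (HoKalman.hankelOf Ghat) Ahat Bhat Chat) :
    ∃ T ∈ Matrix.orthogonalGroup (Fin n) ℝ,
      max (HoKalman.frobNorm (Bbar - T.transpose * Bhat))
          (HoKalman.frobNorm (Cbar - Chat * T))
        ≤ Real.sqrt ((L : ℝ) / HoKalman.nthSingularValue n Lmat)
          * HoKalman.frobNorm (HoKalman.markovMatrix A B C L - Ghat) ∧
      HoKalman.frobNorm (Abar - T.transpose * Ahat * T)
        ≤ Real.sqrt (L : ℝ)
          * ((HoKalman.specNorm (HoKalman.clippedHankel A B C L)
                + HoKalman.specNorm (HoKalman.hankelOf Ghat))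
              / HoKalman.nthSingularValue n Lmat ^ 2
            + 1 / HoKalman.nthSingularValue n Lmat)
          * HoKalman.frobNorm (HoKalman.markovMatrix A B C L - Ghat) := by
  open HoKalman in
  obtain ⟨K, U, s, V, O, Q, Od, Qd, hK, hsvd, rfl, rfl, hOd, hQd, hC, hB, hA⟩ := hbar
  obtain ⟨K', U', s', V', O', Q', Od', Qd', hK', hsvd', rfl, rfl, hOd', hQd', hC', hB', hA'⟩ := hhat
  -- `H⁻` factors through `ℝⁿ`, so `Lmat` and the approximation in the exact run both equal `H⁻`.
  have hrank : (hankelMinus (clippedHankel A B C L)).rank ≤ n := by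
    rw [hankelMinus_clippedHankel]
    exact (Matrix.rank_mul_le_left _ _).trans
      ((Matrix.rank_le_card_width _).trans_eq (Fintype.card_fin n))
  obtain rfl := hLmat.eq_of_rank_le hrank
  obtain rfl := hK.eq_of_rank_le hrank
  have hs : ∀ i, nthSingularValue n (hankelMinus (clippedHankel A B C L)) ≤ s i :=
    fun i => hsvd.nthSingularValue_le hn i
  obtain ⟨σ, hσdef⟩ : ∃ σ, nthSingularValue n (hankelMinus (clippedHankel A B C L)) = σ := ⟨_, rfl⟩
  rw [hσdef] at hσ hG hs ⊢
  obtain ⟨g, hg⟩ : ∃ g, frobNorm (markovMatrix A B C L - Ghat) = g := ⟨_, rfl⟩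
  have hg0 : 0 ≤ g := hg ▸ frobNorm_nonneg _
  obtain ⟨d, hd⟩ : ∃ d, frobNorm (hankelOf Ghat - clippedHankel A B C L) = d := ⟨_, rfl⟩
  have hd0 : 0 ≤ d := hd ▸ frobNorm_nonneg _
  have hL0 : (0 : ℝ) < L := by exact_mod_cast (by omega : 0 < L)
  have hdg : 2 * d ^ 2 ≤ L * g ^ 2 := by
    have h1 : hankelOf Ghat - clippedHankel A B C L = hankelOf (Ghat - markovMatrix A B C L) := by
      rw [clippedHankel_eq_hankelOf]; rfl
    have h2 := frobNorm_hankelOf_sq_le (Ghat - markovMatrix A B C L)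
    rw [← h1, hd, frobNorm_sub_rev, hg] at h2
    have h3 : 2 * ((L / 2 : ℕ) : ℝ) ≤ L := by exact_mod_cast Nat.mul_div_le L 2
    nlinarith [mul_le_mul_of_nonneg_right h3 (sq_nonneg g)]
  rw [hg] at hG ⊢
  -- The hypothesis gives `g² ≤ σ² / (8 L)`, and `d² ≤ L g² / 2`.
  have hdσ : d ≤ σ / 4 := by
    refine le_of_sq_le_sq ?_ (by positivity)
    have h1 := pow_le_pow_left₀ hg0 hG 2
    rw [div_pow, mul_pow, Real.sq_sqrt (by positivity), le_div_iff₀ (by positivity)] at h1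
    nlinarith
  -- the rank `n` approximations
  have hminus : frobNorm (hankelMinus (hankelOf Ghat) - hankelMinus (clippedHankel A B C L)) ≤ d :=
    (frobNorm_hankelMinus_sub_le _ _).trans_eq hd
  have hplus : frobNorm (hankelPlus (hankelOf Ghat) - hankelPlus (clippedHankel A B C L)) ≤ d :=
    (frobNorm_hankelPlus_sub_le _ _).trans_eq hd
  have he : 3 * frobNorm (K' - hankelMinus (clippedHankel A B C L)) ^ 2 ≤ 4 * d ^ 2 := by
    have h1 := hK'.three_mul_frobNorm_sub_sq_le hsvd hsvd' hσ hs (hminus.trans hdσ)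
    have h2 := pow_le_pow_left₀ (frobNorm_nonneg _) hminus 2
    linarith
  have hspos : ∀ i, 0 < s i := fun i => hσ.trans_le (hs i)
  -- From `3 e² ≤ 4 d²` and `d ≤ σ / 4` comes `e ≤ σ / √12 < 0.29 σ`.
  have hs' : ∀ i, 71 / 100 * σ ≤ s' i := by
    intro i
    have h1 := hsvd.sub_le hsvd' hσ.le hs i
    have h2 := specNorm_le_frobNorm (K' - hankelMinus (clippedHankel A B C L))
    have h3 : frobNorm (K' - hankelMinus (clippedHankel A B C L)) ≤ 29 / 100 * σ := by
      refine le_of_sq_le_sq ?_ (by positivity)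
      nlinarith
    linarith
  have hs'pos : ∀ i, 0 < s' i := fun i => lt_of_lt_of_le (by positivity) (hs' i)
  -- alignment
  obtain ⟨T, hT, x, hx, hx1, hx2⟩ := exists_orthogonal_procrustes hsvd.transpose_mul_sqrt
    hsvd.sqrt_mul_transpose hsvd'.transpose_mul_sqrt hsvd'.sqrt_mul_transpose hs
  rw [hsvd.sqrt_mul_sqrt, hsvd'.sqrt_mul_sqrt] at hx1 hx2
  have hTT : T * Tᵀ = 1 := (Matrix.mem_orthogonalGroup_iff (Fin n) ℝ).mp hT
  have hTT' : Tᵀ * T = 1 := mul_eq_one_comm.mp hTT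
  have hx0 : 0 ≤ x := by rw [← hx]; positivity
  have hxd := procrustes_scalar_bound hσ hx0 hx1 hx2 he hd0 hdσ
  have hxg : x ≤ (√(L / σ) * g) ^ 2 := by
    rw [mul_pow, Real.sq_sqrt (by positivity), div_mul_eq_mul_div, le_div_iff₀ hσ]
    nlinarith
  obtain ⟨hOdO, hOOd⟩ := hOd.mul_eq_one hsvd.orth_left hspos
  obtain ⟨hOdO', -⟩ := hOd'.mul_eq_one hsvd'.orth_left hs'pos
  obtain ⟨hQdQ, hQQd⟩ := hQd.transpose_sqrt_mul.mul_eq_one hsvd.orth_right hspos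
  obtain ⟨hQdQ', -⟩ := hQd'.transpose_sqrt_mul.mul_eq_one hsvd'.orth_right hs'pos
  have hOdn := hOd.specNorm_le hsvd.orth_left hσ hs
  have hOdn' := hOd'.specNorm_le hsvd'.orth_left (by positivity) hs'
  have hQdn := hQd.transpose_sqrt_mul.specNorm_le hsvd.orth_right hσ hs
  have hQdn' := hQd'.transpose_sqrt_mul.specNorm_le hsvd'.orth_right (by positivity) hs'
  rw [specNorm_transpose] at hQdn hQdn'
  obtain ⟨O, hO⟩ : ∃ O, (U * diagonal fun i => √(s i)) = O := ⟨_, rfl⟩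
  obtain ⟨Q, hQ⟩ : ∃ Q, (diagonal fun i => √(s i)) * Vᵀ = Q := ⟨_, rfl⟩
  obtain ⟨O', hO'⟩ : ∃ O, (U' * diagonal fun i => √(s' i)) = O := ⟨_, rfl⟩
  obtain ⟨Q', hQ'⟩ : ∃ Q, (diagonal fun i => √(s' i)) * V'ᵀ = Q := ⟨_, rfl⟩
  have hVQ : (V * diagonal fun i => √(s i)) = Qᵀ := by
    rw [← hQ, transpose_mul, transpose_transpose, diagonal_transpose]
  have hVQ' : (V' * diagonal fun i => √(s' i)) = Q'ᵀ := by
    rw [← hQ', transpose_mul, transpose_transpose, diagonal_transpose]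
  rw [hVQ, ← transpose_mul, ← transpose_one, transpose_inj] at hQdQ
  rw [hVQ', ← transpose_mul, ← transpose_one, transpose_inj] at hQdQ'
  rw [hVQ, ← transpose_mul, ← transpose_inj, transpose_transpose, transpose_mul,
    transpose_transpose] at hQQd
  rw [hO, hQ, hO', hQ'] at hx
  rw [hO] at hOdO hOOd hC
  rw [hO'] at hOdO' hC'
  rw [hQ] at hB
  rw [hQ'] at hB'
  have hBn : frobNorm (Bbar - Tᵀ * Bhat) ≤ frobNorm (Q - Tᵀ * Q') := by
    rw [hB, hB']
    exact frobNorm_submatrix_le (Q - Tᵀ * Q') Function.injective_id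
      (g := fun b : Fin p => (⟨0, Nat.div_pos hL two_pos⟩, b)) fun b b' h => by simpa using h
  have hCn : frobNorm (Cbar - Chat * T) ≤ frobNorm (O - O' * T) := by
    rw [hC, hC']
    exact frobNorm_submatrix_le (O - O' * T)
      (f := fun b : Fin p => (⟨0, Nat.div_pos hL two_pos⟩, b)) (fun b b' h => by simpa using h)
      Function.injective_id
  refine ⟨T, hT, max_le ?_ ?_, ?_⟩
  · refine hBn.trans (le_of_sq_le_sq (le_trans ?_ hxg) (by positivity))
    nlinarith [sq_nonneg (frobNorm (O - O' * T))]
  · refine hCn.trans (le_of_sq_le_sq (le_trans ?_ hxg) (by positivity))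
    nlinarith [sq_nonneg (frobNorm (Q - Tᵀ * Q'))]
  -- the state matrix
  have hH : hankelPlus (clippedHankel A B C L) = O * Abar * Q := by
    obtain ⟨hF, hGV⟩ := hsvd.proj_of_eq_mul hspos (hankelMinus_clippedHankel A B C L)
    calc hankelPlus (clippedHankel A B C L)
        = (U * Uᵀ * observabilityMatrix A C (L / 2)) *
          (A * (controllabilityMatrix A B (L / 2) * (V * Vᵀ))) := by
          rw [hF, hGV, hankelPlus_clippedHankel]
      _ = (U * Uᵀ) * hankelPlus (clippedHankel A B C L) * (V * Vᵀ) := by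
          rw [hankelPlus_clippedHankel]; simp only [Matrix.mul_assoc]
      _ = O * Abar * Q := by
          rw [← hOOd, ← hQQd, hA]; simp only [Matrix.mul_assoc]
  have hAn : specNorm Abar ≤ specNorm (clippedHankel A B C L) / σ := by
    have h1 := specNorm_hankelPlus_le (clippedHankel A B C L)
    have h2 := specNorm_nonneg (clippedHankel A B C L)
    rw [hA]
    calc specNorm (Od * hankelPlus (clippedHankel A B C L) * Qd)
        ≤ (√σ)⁻¹ * specNorm (clippedHankel A B C L) * (√σ)⁻¹ :=
          (specNorm_mul_le _ _).trans (mul_le_mul ((specNorm_mul_le _ _).trans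
            (mul_le_mul hOdn h1 (specNorm_nonneg _) (by positivity))) hQdn (specNorm_nonneg _)
              (by positivity))
      _ = specNorm (clippedHankel A B C L) / σ := by
          have h3 := Real.mul_self_sqrt hσ.le
          rw [mul_right_comm, ← mul_inv, h3, inv_mul_eq_div]
  have hTn : specNorm T ≤ 1 := specNorm_le_one_of_transpose_mul_self hTT'
  -- The aligned factors `O' T` and `Tᵀ Q'` have one-sided inverses `Tᵀ Od'` and `Qd' T`, which turn
  -- `Â` into `Tᵀ Â T`.
  have key := frobNorm_sub_pinv_mul_le (P := O' * T) (W := Tᵀ * Q') (X := Tᵀ * Od') (Y := Qd' * T)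
    (r := (√(71 / 100 * σ))⁻¹) (H' := hankelPlus (hankelOf Ghat)) hH
    (by rw [Matrix.mul_assoc, ← Matrix.mul_assoc Od', hOdO', Matrix.one_mul, hTT'])
    (by rw [Matrix.mul_assoc, ← Matrix.mul_assoc Q', hQdQ', Matrix.one_mul, hTT'])
    ((specNorm_mul_le _ _).trans (by
      rw [specNorm_transpose]
      exact (mul_le_of_le_one_left (specNorm_nonneg _) hTn).trans hOdn'))
    ((specNorm_mul_le _ _).trans ((mul_le_of_le_one_right (specNorm_nonneg _) hTn).trans hQdn')) hAn
  have hAhat : Tᵀ * Od' * hankelPlus (hankelOf Ghat) * (Qd' * T) = Tᵀ * Ahat * T := by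
    rw [hA']; simp only [Matrix.mul_assoc]
  rw [hAhat] at key
  have hi : 0 < n := hn
  rw [mul_right_comm, mul_comm (√(L : ℝ) * g)]
  refine realization_scalar_bound hσ ?_ (by rw [hx]; exact hxd) hd0 hdσ ?_ (by positivity) ?_ ?_
    (key.trans (by gcongr))
  · rw [inv_pow, Real.sq_sqrt (by positivity)]
  · rwa [mul_pow, Real.sq_sqrt hL0.le]
  · exact (hs ⟨0, hi⟩).trans ((hsvd.le_specNorm _).trans (specNorm_hankelMinus_le _))
  · have := specNorm_sub_le_frobNorm_add (clippedHankel A B C L) (hankelOf Ghat)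
    rwa [frobNorm_sub_rev, hd] at this
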